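/- Let $p$ be a prime, $n\in\{1,2,\ldots\}$, $\alpha\in\mathbb N_0^n$, and let $E$ be a Hausdorff, sequentially complete, locally convex topological vector space over $\mathbb Q_p$ (locally convex: the open $\mathbb Z_p$-submodules of $E$ form a basis of the filter of $0$-neighbourhoods). For a cartesian set $V=V_1\times\cdots\times V_n\subseteq\mathbb Q_p^n$ (each $V_i\subseteq \mathbb Q_p$ without isolated points) and $\beta\in\mathbb N_0^n$, let $V^{<\beta>}$ be the set of all $x=(x^{(1)},\ldots,x^{(n)})\in\prod_{i=1}^n\mathbb Q_p^{1+\beta_i}$, $x^{(i)}=(x^{(i)}_0,\ldots,x^{(i)}_{\beta_i})$, such that $(x^{(1)}_{j_1},\ldots,x^{(n)}_{j_n})\in V$ for all choices of $j_i\in\{0,\ldots,\beta_i\}$, and let $V^{>\beta<}$ be the set of those $x\in V^{<\beta>}$ for which the entries of each $x^{(i)}$ are pairwise distinct. For $f\colon V\to E$ and $x\in V^{>\beta<}$ put $$f^{>\beta<}(x)=\sum_{j_1=0}^{\beta_1}\cdots\sum_{j_n=0}^{\beta_n}\Bigl(\prod_{i=1}^n\prod_{k\ne j_i}\frac1{x^{(i)}_{j_i}-x^{(i)}_{k}}\Bigr)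 f(x^{(1)}_{j_1},\ldots,x^{(n)}_{j_n}),$$ where $k$ ranges over $\{0,\ldots,\beta_i\}\setminus\{j_i\}$. Let $C^\alpha(\mathbb Z_p^n,E)$ be the space of all $f\colon\mathbb Z_p^n\to E$ such that, for each relatively open cartesian subset $V\subseteq\mathbb Z_p^n$ and each $\beta\in\mathbb N_0^n$ with $\beta\le\alpha$, the map $(f|_V)^{>\beta<}$ has a (necessarily unique) continuous extension $(f|_V)^{<\beta>}\colon V^{<\beta>}\to E$; it carries the initial topology with respect to the maps $f\mapsto (f|_V)^{<\beta>}$ into $C(V^{<\beta>},E)$, the latter with the compact-open topology. Define $w_\alpha\colon\mathbb N_0^n\to\,]0,\infty[$ by $w_\alpha(\nu)=\prod_{i=1}^n\max\{1,\nu_i\}^{\alpha_i}$; thus $w_\alpha(\nu)=\nu^\alpha=\nu_1^{\alpha_1}\cdots\nu_n^{\alpha_n}$, except that factors with $\nu_i=0$ are read as $1$. Let $c_0(\mathbb N_0^n,w_\alpha,E)$ be the space of all families $b=(b_\nu)_{\nu\in\mathbb N_0^n}$ in $E$ such that, for each continuous ultrametric seminorm $q$ on $E$ and each $\varepsilon>0$,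 one has $w_\alpha(\nu)\,q(b_\nu)<\varepsilon$ for all but finitely many $\nu$; it carries the vector topology defined by the seminorms $\|b\|_{w_\alpha,q}=\sup_\nu w_\alpha(\nu)\,q(b_\nu)$. Then the map $$A^\alpha_E\colon C^\alpha(\mathbb Z_p^n,E)\to c_0(\mathbb N_0^n,w_\alpha,E),\quad f\mapsto (a_\nu(f))_{\nu\in\mathbb N_0^n},$$ taking a function to its Mahler coefficients $$a_\nu(f)=\sum_{\mu\le\nu}(-1)^{|\nu|-|\mu|}\prod_{i=1}^n\binom{\nu_i}{\mu_i}\, f(\mu),$$ is well defined and is an isomorphism of topological vector spaces. -/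

import Mathlib

open Topology

noncomputable section

/-! ### Maps of class `C^α` on subsets of `𝕜ⁿ` -/

section CAlpha

variable {n : ℕ} {𝕜 : Type*} [Field 𝕜] [TopologicalSpace 𝕜]

/-- A subset of `𝕜ⁿ` is cartesian if it is a product of `n` subsets of `𝕜` without isolated
points. -/
def IsCartesian (V : Set (Fin n → 𝕜)) : Prop :=
  ∃ S : Fin n → Set 𝕜, (∀ i, Preperfect (S i)) ∧ V = Set.pi Set.univ S

/-- `V` is a cartesian, relatively open subset of `U`. -/
structure IsOpenCartesianIn (V U : Set (Fin n → 𝕜)) : Prop where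
  subset : V ⊆ U
  isCartesian : IsCartesian V
  isOpen : ∃ O : Set (Fin n → 𝕜), IsOpen O ∧ V = U ∩ O

/-- The domain `U^{<β>} ⊆ ∏ᵢ 𝕜^{1+βᵢ}`: all `x = (x⁽¹⁾, …, x⁽ⁿ⁾)` such that
`(x⁽¹⁾_{j₁}, …, x⁽ⁿ⁾_{jₙ}) ∈ U` for all choices of indices `jᵢ ∈ {0, …, βᵢ}`. -/
def extDomain (U : Set (Fin n → 𝕜)) (β : Fin n → ℕ) : Set ((i : Fin n) → Fin (β i + 1) → 𝕜) :=
  {x | ∀ j : (i : Fin n) → Fin (β i + 1), (fun i => x i (j i)) ∈ U}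

variable {E : Type*} [AddCommGroup E] [Module 𝕜 E]

/-- The iterated partial difference quotient `f^{>β<}`. It is meaningful on the set `U^{>β<}`
of those `x ∈ U^{<β>}` for which the entries of each `x⁽ⁱ⁾` are pairwise distinct, and it is
only used there. -/
def diffQuot {U : Set (Fin n → 𝕜)} (f : U → E) (β : Fin n → ℕ) (x : extDomain U β) : E :=
  ∑ j : (i : Fin n) → Fin (β i + 1),
    (∏ i, ∏ k ∈ Finset.univ.erase (j i), (x.1 i (j i) - x.1 i k)⁻¹) •
      f ⟨fun i => x.1 i (j i), x.2 j⟩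

variable [TopologicalSpace E]

/-- `g : U^{<β>} → E` is a continuous extension of `f^{>β<} : U^{>β<} → E`. -/
def IsContExtension {U : Set (Fin n → 𝕜)} (f : U → E) (β : Fin n → ℕ)
    (g : extDomain U β → E) : Prop :=
  Continuous g ∧ ∀ x : extDomain U β, (∀ i, Function.Injective (x.1 i)) → g x = diffQuot f β x

/-- `f : U → E` is `C^α`: for every cartesian, relatively open `V ⊆ U` and every multi-index
`β ≤ α`, the map `(f|_V)^{>β<}` has a continuous extension to `V^{<β>}`. -/
def IsCAlpha (U : Set (Fin n → 𝕜)) (α : Fin n → ℕ) (f : U → E) : Prop :=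
  ∀ (V : Set (Fin n → 𝕜)) (hV : IsOpenCartesianIn V U) (β : Fin n → ℕ), β ≤ α →
    ∃ g : extDomain V β → E, IsContExtension (f ∘ Set.inclusion hV.subset) β g

variable (𝕜 E) in
/-- The vector space of all `C^α`-maps `U → E`, as a space of functions. -/
def cAlphaSubmodule [IsTopologicalAddGroup E] [ContinuousConstSMul 𝕜 E]
    (U : Set (Fin n → 𝕜)) (α : Fin n → ℕ) : Submodule 𝕜 (U → E) where
  carrier := {f | IsCAlpha U α f}
  zero_mem' := fun V hV β hβ =>
    ⟨fun _ => 0, continuous_const, fun x _ => by simp [diffQuot]⟩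
  add_mem' := by
    intro f₁ f₂ h₁ h₂ V hV β hβ
    obtain ⟨g₁, hc₁, hg₁⟩ := h₁ V hV β hβ
    obtain ⟨g₂, hc₂, hg₂⟩ := h₂ V hV β hβ
    refine ⟨fun x => g₁ x + g₂ x, hc₁.add hc₂, fun x hx => ?_⟩
    simp only [hg₁ x hx, hg₂ x hx, diffQuot, Function.comp_apply, Pi.add_apply, smul_add,
      Finset.sum_add_distrib]
  smul_mem' := by
    intro c f h V hV β hβ
    obtain ⟨g, hc, hg⟩ := h V hV β hβ
    refine ⟨fun x => c • g x, hc.const_smul c, fun x hx => ?_⟩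
    simp only [hg x hx, diffQuot, Function.comp_apply, Pi.smul_apply, Finset.smul_sum]
    exact Finset.sum_congr rfl fun j _ => smul_comm _ _ _

variable [IsTopologicalAddGroup E] [ContinuousConstSMul 𝕜 E]

variable (𝕜 E) in
/-- The space `C^α(U, E)`. This is a type of its own, so that it does not carry the topology of
pointwise convergence. -/
def CAlphaSpace (U : Set (Fin n → 𝕜)) (α : Fin n → ℕ) : Type _ :=
  cAlphaSubmodule 𝕜 E U α

instance (U : Set (Fin n → 𝕜)) (α : Fin n → ℕ) : AddCommGroup (CAlphaSpace 𝕜 E U α) :=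
  inferInstanceAs (AddCommGroup (cAlphaSubmodule 𝕜 E U α))

instance (U : Set (Fin n → 𝕜)) (α : Fin n → ℕ) : Module 𝕜 (CAlphaSpace 𝕜 E U α) :=
  inferInstanceAs (Module 𝕜 (cAlphaSubmodule 𝕜 E U α))

instance (U : Set (Fin n → 𝕜)) (α : Fin n → ℕ) :
    CoeFun (CAlphaSpace 𝕜 E U α) (fun _ => U → E) :=
  ⟨fun f => f.1⟩

/-- The continuous extension `(f|_V)^{<β>} : V^{<β>} → E`. It is unique if `𝕜` and `E` are
Hausdorff, since `V^{>β<}` is dense in `V^{<β>}` for cartesian `V`. -/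
def extDiffQuot {U : Set (Fin n → 𝕜)} {α : Fin n → ℕ} (f : CAlphaSpace 𝕜 E U α)
    {β : Fin n → ℕ} (hβ : β ≤ α) {V : Set (Fin n → 𝕜)} (hV : IsOpenCartesianIn V U) :
    C(extDomain V β, E) :=
  ⟨(f.2 V hV β hβ).choose, (f.2 V hV β hβ).choose_spec.1⟩

/-- The compact-open `C^α`-topology: the initial topology with respect to the maps
`C^α(U, E) → C(V^{<β>}, E)`, `f ↦ (f|_V)^{<β>}`, for all `β ≤ α` and all cartesian, relatively
open `V ⊆ U`, where the spaces on the right carry the compact-open topology. -/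
instance (U : Set (Fin n → 𝕜)) (α : Fin n → ℕ) : TopologicalSpace (CAlphaSpace 𝕜 E U α) :=
  ⨅ (β : Fin n → ℕ) (hβ : β ≤ α) (V : Set (Fin n → 𝕜)) (hV : IsOpenCartesianIn V U),
    TopologicalSpace.induced (fun f => extDiffQuot f hβ hV) ContinuousMap.compactOpen

end CAlpha

/-! ### Locally convex spaces over ultrametric fields and weighted `c₀`-spaces -/

section CZero

/-- A topological vector space over an ultrametric field `𝕜` is locally convex if its open
`𝕆`-submodules form a basis of the filter of `0`-neighbourhoods, where `𝕆` is the closed unit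
ball of `𝕜`. -/
def IsUltraLocallyConvex (𝕜 E : Type*) [NormedField 𝕜] [AddCommGroup E] [Module 𝕜 E]
    [TopologicalSpace E] : Prop :=
  (𝓝 (0 : E)).HasBasis
    (fun S : AddSubgroup E =>
      IsOpen (S : Set E) ∧ ∀ a : 𝕜, ‖a‖ ≤ 1 → ∀ x ∈ S, a • x ∈ S)
    (fun S => (S : Set E))

variable (𝕜 E : Type*) [NormedField 𝕜] [AddCommGroup E] [Module 𝕜 E] [TopologicalSpace E]

/-- The continuous ultrametric seminorms on `E`. -/
def ContUltraSeminorm : Type _ :=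
  {q : Seminorm 𝕜 E // Continuous q ∧ IsNonarchimedean q}

instance : Nonempty (ContUltraSeminorm 𝕜 E) :=
  ⟨⟨0, continuous_const, fun _ _ => by simp⟩⟩

variable {X : Type*} (w : X → Set.Ioi (0 : ℝ))

/-- The vector space `c₀(X, w, E)`, as a space of functions. -/
def cZeroSubmodule : Submodule 𝕜 (X → E) where
  carrier := {f | ∀ q : ContUltraSeminorm 𝕜 E, ∀ ε > (0 : ℝ),
    ∃ Φ : Finset X, ∀ x ∉ Φ, (w x : ℝ) * q.1 (f x) < ε}
  zero_mem' := fun q ε hε => ⟨∅, fun x _ => by simpa using hε⟩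
  add_mem' := by
    classical
    intro f g hf hg q ε hε
    obtain ⟨Φ, hΦ⟩ := hf q (ε / 2) (half_pos hε)
    obtain ⟨Ψ, hΨ⟩ := hg q (ε / 2) (half_pos hε)
    refine ⟨Φ ∪ Ψ, fun x hx => ?_⟩
    rw [Finset.notMem_union] at hx
    have h := mul_le_mul_of_nonneg_left (map_add_le_add q.1 (f x) (g x)) (w x).2.le
    have h₁ := hΦ x hx.1
    have h₂ := hΨ x hx.2
    rw [mul_add] at h
    simp only [Pi.add_apply]
    linarith
  smul_mem' := by
    intro c f hf q ε hε
    have hc : (0 : ℝ) < ‖c‖ + 1 := by positivity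
    obtain ⟨Φ, hΦ⟩ := hf q (ε / (‖c‖ + 1)) (div_pos hε hc)
    refine ⟨Φ, fun x hx => ?_⟩
    have h := (lt_div_iff₀ hc).1 (hΦ x hx)
    have h₀ : 0 ≤ (w x : ℝ) * q.1 (f x) := mul_nonneg (w x).2.le (apply_nonneg _ _)
    rw [Pi.smul_apply, map_smul_eq_mul]
    nlinarith

/-- The space `c₀(X, w, E)`. This is a type of its own, so that it does not carry the topology
of pointwise convergence. -/
def CZeroSpace : Type _ := cZeroSubmodule 𝕜 E w

instance : AddCommGroup (CZeroSpace 𝕜 E w) :=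
  inferInstanceAs (AddCommGroup (cZeroSubmodule 𝕜 E w))

instance : Module 𝕜 (CZeroSpace 𝕜 E w) :=
  inferInstanceAs (Module 𝕜 (cZeroSubmodule 𝕜 E w))

instance : CoeFun (CZeroSpace 𝕜 E w) (fun _ => X → E) := ⟨fun f => f.1⟩

variable {𝕜 E w}

theorem CZeroSpace.bddAbove (q : ContUltraSeminorm 𝕜 E) (f : CZeroSpace 𝕜 E w) :
    BddAbove (Set.range fun x => (w x : ℝ) * q.1 (f x)) := by
  obtain ⟨Φ, hΦ⟩ := f.2 q 1 one_pos
  refine ⟨max 1 (∑ x ∈ Φ, (w x : ℝ) * q.1 (f x)), ?_⟩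
  rintro _ ⟨x, rfl⟩
  by_cases hx : x ∈ Φ
  · exact le_max_of_le_right (Finset.single_le_sum
      (f := fun x => (w x : ℝ) * q.1 (f x))
      (fun y _ => mul_nonneg (w y).2.le (apply_nonneg _ _)) hx)
  · exact le_max_of_le_left (hΦ x hx).le

variable (w) in
/-- The seminorm `‖f‖_{w,q} = sup {w(x) q(f(x)) : x ∈ X}` on `c₀(X, w, E)`. -/
def cZeroSeminorm (q : ContUltraSeminorm 𝕜 E) : Seminorm 𝕜 (CZeroSpace 𝕜 E w) :=
  Seminorm.of (fun f => ⨆ x, (w x : ℝ) * q.1 (f x))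
    (by
      intro f g
      have h₀ : ∀ h : CZeroSpace 𝕜 E w, 0 ≤ ⨆ x, (w x : ℝ) * q.1 (h x) := fun h =>
        Real.iSup_nonneg fun x => mul_nonneg (w x).2.le (apply_nonneg _ _)
      refine Real.iSup_le (fun x => ?_) (add_nonneg (h₀ f) (h₀ g))
      have h := mul_le_mul_of_nonneg_left (map_add_le_add q.1 (f x) (g x)) (w x).2.le
      rw [mul_add] at h
      exact h.trans (add_le_add (le_ciSup (CZeroSpace.bddAbove q f) x)
        (le_ciSup (CZeroSpace.bddAbove q g) x)))
    (by
      intro c f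
      rw [Real.mul_iSup_of_nonneg (norm_nonneg c)]
      refine iSup_congr fun x => ?_
      have : q.1 ((c • f) x) = ‖c‖ * q.1 (f x) := map_smul_eq_mul q.1 c (f x)
      rw [this]
      ring)

/-- The topology on `c₀(X, w, E)` defined by the seminorms `‖·‖_{w,q}`, for `q` ranging through
the continuous ultrametric seminorms on `E`. -/
instance : TopologicalSpace (CZeroSpace 𝕜 E w) :=
  SeminormFamily.moduleFilterBasis (𝕜 := 𝕜) (fun q : ContUltraSeminorm 𝕜 E => cZeroSeminorm w q)
    |>.topology

end CZero

/-! ### Mahler coefficients -/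

section Mahler

variable (p : ℕ) [Fact p.Prime] {n : ℕ}

variable (n) in
/-- `ℤ_pⁿ` as a subset of `ℚ_pⁿ`. -/
def zpPow : Set (Fin n → ℚ_[p]) := {x | ∀ i, ‖x i‖ ≤ 1}

/-- The point of `ℤ_pⁿ` given by a multi-index. -/
def zpPow.ofNat (μ : Fin n → ℕ) : zpPow p n :=
  ⟨fun i => (μ i : ℚ_[p]), fun i => by
    simpa using Padic.norm_int_le_one (p := p) (μ i : ℤ)⟩

variable {p} in
/-- The `ν`-th Mahler coefficient
`a_ν(f) = ∑_{μ ≤ ν} (-1)^{|ν| - |μ|} (ν choose μ) f(μ)` of `f : ℤ_pⁿ → E`. -/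
def mahlerCoeff {E : Type*} [AddCommGroup E] [Module ℚ_[p] E] (f : zpPow p n → E)
    (ν : Fin n → ℕ) : E :=
  ∑ μ ∈ Finset.Iic ν,
    ((-1 : ℚ_[p]) ^ ((∑ i, ν i) - ∑ i, μ i) * ∏ i, ((ν i).choose (μ i) : ℚ_[p])) •
      f (zpPow.ofNat p μ)

/-- The weight `ν ↦ ν^α = ∏ᵢ νᵢ^{αᵢ}` on multi-indices, where a factor with `νᵢ = 0` is read
as `1`, so that the weight is positive. -/
def mahlerWeight (α ν : Fin n → ℕ) : Set.Ioi (0 : ℝ) :=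
  ⟨∏ i, (max 1 (ν i) : ℝ) ^ α i,
    Set.mem_Ioi.2 (Finset.prod_pos fun _ _ => pow_pos (lt_max_of_lt_left one_pos) _)⟩

end Mahler

end

noncomputable section

/-! Decay of the coefficients. In one variable, take nodes $x_0=\mu_0$, $x_{j+1}=x_j+1+\mu_{j+1}$
and form the divided difference of order $m$ of $g$ as a function of the gaps $\mu\in\mathbb
N_0^{m+1}$. Its Mahler coefficient at $i$ is $c(i)^{-1}a_N(g)$, where $N=m+\sum_k i_k$ and $c(i)$ is
an explicit natural number (`sum_dividedDiff_nodes`). Given $N\ge m$, the index $i$ can be chosen so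
that $c(i)$ is divisible by $q^m$, with $q$ a power of $p$ comparable to $N/m$
(`exists_nodeTotal_eq`). Hence $N^m|a_N(g)|$ is bounded by a constant times a Mahler coefficient of
the continuous function $g^{<m>}$ evaluated at the nodes. Tensoring over the variables gives
`multiMahler_nodeTotal` and `exists_mahlerCoeff_le`. Mahler coefficients are integer combinations of
values, so bounds on $f^{<\beta>}$ pass to them; this yields continuity. They tend to zero because
$f^{<\beta>}$ is uniformly continuous on a compact set (`finite_le_multiMahler`); this yields
membership in $c_0$. Only $V=\mathbb Z_p^n$ is needed here.

Convergence of the series. Vandermonde's identity expands divided differences of $\binom{x}{n}$ into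
binomials with coefficients $1/(j+1)$, $j<n$. So they extend continuously (`chooseDiff`), with norm
at most $\max\{1,n\}^\beta$ (`norm_chooseDiff_le`). For $b\in c_0$ the Mahler series and all its
extended difference quotients therefore converge uniformly, with
$q(f^{<\beta>})\le\|b\|_{w_\alpha,q}$ (`exists_mahlerSeries`). This gives surjectivity and
continuity of the inverse. Injectivity holds because the coefficients determine $f$ on the dense set
$\mathbb N_0^n$. -/

namespace CAlphaMahler

open Finset Filter

/-! ### Divided differences -/

section DividedDiff

variable {K : Type*} [Field K]

/-- The divided difference with nodes `v` and values `F`. -/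
def dividedDiff {m : ℕ} (v F : Fin (m + 1) → K) : K :=
  ∑ j, (∏ k ∈ univ.erase j, (v j - v k)⁻¹) * F j

/-- By Lagrange interpolation the sum is the coefficient of degree $m+1>0$ of the constant
polynomial $1$. -/
theorem sum_prod_inv_sub_eq_zero {m : ℕ} {v : Fin (m + 2) → K} (hv : Function.Injective v) :
    ∑ j, ∏ k ∈ univ.erase j, (v j - v k)⁻¹ = 0 := by
  have h := Lagrange.coeff_eq_sum (s := univ) (v := v) (P := (1 : Polynomial K)) hv.injOn
    (by rw [Polynomial.degree_one]; simp; exact_mod_cast Nat.succ_pos _)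
  simp only [card_univ, Fintype.card_fin, Polynomial.eval_one, one_div, ← prod_inv_distrib] at h
  rw [← h, Polynomial.coeff_one]
  simp

/-- Constants have divided difference zero, so `F 0` may be subtracted from all values. The term at
node $0$ then disappears, and in the others the factor for $k=0$ turns the value into a slope. -/
theorem dividedDiff_succ {m : ℕ} {v : Fin (m + 2) → K} (hv : Function.Injective v)
    (F : Fin (m + 2) → K) :
    dividedDiff v F =
      dividedDiff (Fin.tail v) (fun j => (F j.succ - F 0) / (v j.succ - v 0)) := by
  have h : dividedDiff v F =
      ∑ j, (∏ k ∈ univ.erase j, (v j - v k)⁻¹) * (F j - F 0) := by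
    simp only [mul_sub, sum_sub_distrib, ← sum_mul, sum_prod_inv_sub_eq_zero hv, zero_mul,
      sub_zero, dividedDiff]
  rw [h, Fin.sum_univ_succ, sub_self, mul_zero, zero_add]
  refine sum_congr rfl fun j _ => ?_
  have he : univ.erase j.succ = insert 0 ((univ.erase j).map (Fin.succEmb (m + 1))) := by
    ext k
    refine Fin.cases ?_ (fun k => ?_) k
    · simpa using (Fin.succ_ne_zero j).symm
    · simp
  rw [he, prod_insert (by simp), prod_map]
  simp only [Fin.coe_succEmb, Fin.tail, div_eq_mul_inv]
  ring

theorem dividedDiff_add_const {m : ℕ} (v F : Fin (m + 1) → K) (c : K) :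
    dividedDiff (fun j => c + v j) F = dividedDiff v F := by
  simp [dividedDiff]

theorem dividedDiff_sum {m : ℕ} {ι : Type*} (s : Finset ι) (c : ι → K) (v : Fin (m + 1) → K)
    (F : ι → Fin (m + 1) → K) :
    dividedDiff v (fun j => ∑ i ∈ s, c i * F i j) = ∑ i ∈ s, c i * dividedDiff v (F i) := by
  simp only [dividedDiff, mul_sum]
  rw [sum_comm]
  refine sum_congr rfl fun i _ => sum_congr rfl fun j _ => by ring

end DividedDiff

/-! ### One-dimensional Mahler coefficients as Mahler coefficients of divided differences -/

section OneDim

variable (K : Type*) [Field K]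

/-- The coefficient of `g k` in the `n`-th Mahler coefficient of `g`. -/
def mahlerEntry (n k : ℕ) : K := (-1) ^ (n - k) * (n.choose k : K)

variable {K}

theorem sum_mahlerEntry (g : ℕ → K) (n y : ℕ) :
    ∑ k ∈ Iic n, mahlerEntry K n k * g (y + k) = (fwdDiff 1)^[n] g y := by
  rw [fwdDiff_iter_eq_sum_shift, Nat.range_succ_eq_Iic]
  simp [mahlerEntry]

theorem sum_mahlerEntry_zero (g : ℕ → K) (n : ℕ) :
    ∑ k ∈ Iic n, mahlerEntry K n k * g k = (fwdDiff 1)^[n] g 0 := by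
  simpa using sum_mahlerEntry g n 0

/-- The absorption identity $(j+1)\binom jz=(z+1)\binom{j+1}{z+1}$ trades the variable denominator
$z+1$ for the constant $j+1$. The missing term at $0$ is $g(y)-g(y)$, and differencing forgets the
subtracted constant. -/
theorem sum_mahlerEntry_slope [CharZero K] (g : ℕ → K) (j y : ℕ) :
    ∑ z ∈ Iic j, mahlerEntry K j z * ((g (y + 1 + z) - g y) / ((z : K) + 1)) =
      ((j : K) + 1)⁻¹ * (fwdDiff 1)^[j + 1] g y := by
  have h1 : ∀ z, mahlerEntry K j z * ((g (y + 1 + z) - g y) / ((z : K) + 1)) =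
      ((j : K) + 1)⁻¹ * (mahlerEntry K (j + 1) (z + 1) * (g (y + (z + 1)) - g y)) := by
    intro z
    have hz : ((z : K) + 1) ≠ 0 := Nat.cast_add_one_ne_zero z
    have hj : ((j : K) + 1) ≠ 0 := Nat.cast_add_one_ne_zero j
    have hc : ((j : K) + 1) * (j.choose z : K) = ((j + 1).choose (z + 1) : K) * ((z : K) + 1) := by
      exact_mod_cast Nat.add_one_mul_choose_eq j z
    have hy : y + 1 + z = y + (z + 1) := by ring
    rw [hy, mahlerEntry, mahlerEntry, Nat.add_sub_add_right]
    rw [mul_div_assoc', div_eq_iff hz, ← mul_right_inj' hj, ← mul_assoc _ (_ * _) (_ + 1),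
      ← mul_assoc ((j : K) + 1) ((j : K) + 1)⁻¹, mul_inv_cancel₀ hj]
    linear_combination (-1) ^ (j - z) * (g (y + (z + 1)) - g y) * hc
  rw [sum_congr rfl fun z _ => h1 z, ← mul_sum]
  congr 1
  have h2 := sum_mahlerEntry (fun x => g x - g y) (j + 1) y
  rw [← Nat.range_succ_eq_Iic, sum_range_succ'] at h2
  simp only [add_zero, sub_self, mul_zero] at h2
  rw [← Nat.range_succ_eq_Iic, h2, Function.iterate_succ_apply, Function.iterate_succ_apply]
  exact congrArg (fun G => (fwdDiff 1)^[j] G y) (funext fun x => by simp [fwdDiff])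

theorem fwdDiff_iter_comp_fwdDiff_iter (g : ℕ → K) (i j : ℕ) :
    ∑ y ∈ Iic i, mahlerEntry K i y * (fwdDiff 1)^[j] g y = (fwdDiff 1)^[i + j] g 0 := by
  rw [sum_mahlerEntry_zero, Function.iterate_add_apply]

/-- The increasing sequence of nodes with prescribed gaps. -/
def nodes : (m : ℕ) → (Fin (m + 1) → ℕ) → Fin (m + 1) → ℕ
  | 0, μ => μ
  | m + 1, μ => Fin.cons (μ 0) (fun j => μ 0 + 1 + nodes m (Fin.tail μ) j)

theorem nodes_injective (m : ℕ) (μ : Fin (m + 1) → ℕ) : Function.Injective (nodes m μ) := by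
  induction m with
  | zero => exact fun a b _ => Fin.ext (by omega)
  | succ m ih =>
    rw [nodes, Fin.cons_injective_iff]
    refine ⟨?_, fun a b h => ih (Fin.tail μ) (Nat.add_left_cancel h)⟩
    rintro ⟨j, hj⟩
    dsimp only at hj
    omega

/-- For $N=p^s$ this makes the nodes uniformly $p$-adically continuous in the gaps. -/
theorem nodes_modEq (N m : ℕ) {μ μ' : Fin (m + 1) → ℕ} (h : ∀ k, μ k ≡ μ' k [MOD N])
    (j : Fin (m + 1)) : nodes m μ j ≡ nodes m μ' j [MOD N] := by
  induction m with
  | zero => exact h j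
  | succ m ih =>
    refine Fin.cases (h 0) (fun j => ?_) j
    exact ((h 0).add_right 1).add (ih (fun k => h k.succ) j)

/-- The order of the Mahler coefficient computed by `sum_dividedDiff_nodes`. -/
def nodeTotal : (m : ℕ) → (Fin (m + 1) → ℕ) → ℕ
  | 0, i => i 0
  | m + 1, i => i 0 + 1 + nodeTotal m (Fin.tail i)

/-- The denominator occurring in `sum_dividedDiff_nodes`. -/
def nodeConst : (m : ℕ) → (Fin (m + 1) → ℕ) → ℕ
  | 0, _ => 1
  | m + 1, i => (nodeTotal m (Fin.tail i) + 1) * nodeConst m (Fin.tail i)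

theorem nodeConst_ne_zero (m : ℕ) (i : Fin (m + 1) → ℕ) : nodeConst m i ≠ 0 := by
  induction m with
  | zero => exact one_ne_zero
  | succ m ih => exact mul_ne_zero (Nat.succ_ne_zero _) (ih _)

theorem sum_Iic_cons {M : Type*} [AddCommMonoid M] {m : ℕ} (i : Fin (m + 1) → ℕ)
    (F : (Fin (m + 1) → ℕ) → M) :
    ∑ μ ∈ Iic i, F μ = ∑ a ∈ Iic (i 0), ∑ μ ∈ Iic (Fin.tail i), F (Fin.cons a μ) := by
  rw [← sum_product']
  symm
  refine sum_nbij' (fun x => Fin.cons x.1 x.2) (fun μ => (μ 0, Fin.tail μ)) ?_ ?_ ?_ ?_ ?_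
  · rintro ⟨a, μ⟩ h
    simp only [mem_product, mem_Iic] at h
    rw [mem_Iic]
    exact fun k => Fin.cases h.1 (fun k => h.2 k) k
  · intro μ h
    simp only [mem_product, mem_Iic] at h ⊢
    exact ⟨h 0, fun k => h k.succ⟩
  · rintro ⟨a, μ⟩ _
    simp
  · intro μ _
    simp
  · rintro ⟨a, μ⟩ _
    rfl

/-- Induction on the number of nodes. Splitting off the first node $a$ leaves a divided difference
of the slope $z\mapsto (g(a+1+z)-g(a))/(z+1)$ at the remaining nodes. The induction hypothesis and
`sum_mahlerEntry_slope` turn its sum into a multiple of $\Delta^{N+1}g(a)$, where $N$ is the total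
of the tail; summing over $a$ applies $\Delta^{i_0}$. -/
theorem sum_dividedDiff_nodes [CharZero K] (m : ℕ) (i : Fin (m + 1) → ℕ) (g : ℕ → K) :
    ∑ μ ∈ Iic i, (∏ k, mahlerEntry K (i k) (μ k)) *
        dividedDiff (fun j => (nodes m μ j : K)) (fun j => g (nodes m μ j)) =
      (nodeConst m i : K)⁻¹ * ∑ k ∈ Iic (nodeTotal m i), mahlerEntry K (nodeTotal m i) k * g k := by
  induction m generalizing g with
  | zero =>
    have he : ∀ F : (Fin 1 → ℕ) → K, ∑ μ ∈ Iic i, F μ = ∑ a ∈ Iic (i 0), F (fun _ => a) := by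
      intro F
      refine sum_nbij' (fun μ => μ 0) (fun a _ => a) ?_ ?_ ?_ ?_ ?_
      · intro μ h
        exact mem_Iic.2 (mem_Iic.1 h 0)
      · intro a h
        rw [mem_Iic] at h ⊢
        intro k
        rwa [Fin.eq_zero k]
      · intro μ _
        ext k
        rw [Fin.eq_zero k]
      · intro a _
        rfl
      · intro μ _
        congr 1
        ext k
        rw [Fin.eq_zero k]
    rw [he]
    simp [dividedDiff, nodes, nodeConst, nodeTotal]
  | succ m ih =>
    have h1 : ∀ a : ℕ, ∀ μ : Fin (m + 1) → ℕ,
        dividedDiff (fun j => (nodes (m + 1) (Fin.cons a μ) j : K))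
          (fun j => g (nodes (m + 1) (Fin.cons a μ) j)) =
        dividedDiff (fun j => (nodes m μ j : K))
          (fun j => (g (a + 1 + nodes m μ j) - g a) / ((nodes m μ j : K) + 1)) := by
      intro a μ
      have hn : nodes (m + 1) (Fin.cons a μ) = Fin.cons a (fun j => a + 1 + nodes m μ j) := by
        simp [nodes]
      rw [dividedDiff_succ (v := fun j => (nodes (m + 1) (Fin.cons a μ) j : K))
        (Nat.cast_injective.comp (nodes_injective _ _)), hn]
      rw [← dividedDiff_add_const (fun j => (nodes m μ j : K)) _ ((a : K) + 1)]
      congr 1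
      · ext j
        simp [Fin.tail]
      · ext j
        simp only [Fin.cons_succ, Fin.cons_zero]
        congr 1
        push_cast
        ring
    rw [sum_Iic_cons]
    have h2 : ∀ a ∈ Iic (i 0), ∑ μ ∈ Iic (Fin.tail i),
        (∏ k, mahlerEntry K (i k) ((Fin.cons a μ : Fin (m + 2) → ℕ) k)) *
          dividedDiff (fun j => (nodes (m + 1) (Fin.cons a μ) j : K))
            (fun j => g (nodes (m + 1) (Fin.cons a μ) j)) =
        mahlerEntry K (i 0) a * ((nodeConst m (Fin.tail i) : K)⁻¹ *
          ((((nodeTotal m (Fin.tail i) : ℕ) : K) + 1)⁻¹ *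
            (fwdDiff 1)^[nodeTotal m (Fin.tail i) + 1] g a)) := by
      intro a _
      rw [← sum_mahlerEntry_slope, ← ih (Fin.tail i)
        (fun z => (g (a + 1 + z) - g a) / ((z : K) + 1)), mul_sum]
      refine sum_congr rfl fun μ _ => ?_
      rw [h1, Fin.prod_univ_succ]
      simp only [Fin.cons_zero, Fin.cons_succ, Fin.tail]
      ring
    have h3 : nodeTotal (m + 1) i = i 0 + (nodeTotal m (Fin.tail i) + 1) := by
      rw [nodeTotal, add_assoc (i 0), add_comm 1 (nodeTotal m _)]
    rw [sum_congr rfl h2, sum_mahlerEntry_zero (g := g), h3,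
      ← fwdDiff_iter_comp_fwdDiff_iter, mul_sum, nodeConst]
    refine sum_congr rfl fun a _ => ?_
    push_cast
    rw [mul_inv]
    ring

theorem nodeTotal_const (m q : ℕ) (hq : 0 < q) :
    nodeTotal m (fun _ => q - 1) + 1 = (m + 1) * q := by
  induction m with
  | zero => simp only [nodeTotal]; omega
  | succ m ih =>
    have : nodeTotal (m + 1) (fun _ => q - 1) = q - 1 + 1 + nodeTotal m (fun _ => q - 1) := rfl
    rw [this, add_assoc, ih, add_mul (m + 1)]
    omega

theorem nodeConst_const (m q : ℕ) (hq : 0 < q) :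
    q ^ m ∣ nodeConst m (fun _ => q - 1) := by
  induction m with
  | zero => simp
  | succ m ih =>
    have : nodeConst (m + 1) (fun _ => q - 1) =
      (nodeTotal m (fun _ => q - 1) + 1) * nodeConst m (fun _ => q - 1) := rfl
    rw [this, nodeTotal_const m q hq, pow_succ']
    exact mul_dvd_mul (dvd_mul_left _ _) ih

/-- When all later entries equal $q-1$, each of the $m$ factors of `nodeConst` is a multiple of $q$.
The entry $i_0$ does not enter `nodeConst`, so it is free to adjust the total to $n$. -/
theorem exists_nodeTotal_eq (p : ℕ) [Fact p.Prime] {m n : ℕ} (h : m ≤ n) :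
    ∃ i : Fin (m + 1) → ℕ, nodeTotal m i = n ∧
      (max 1 (n : ℝ)) ^ m * ‖(nodeConst m i : ℚ_[p])‖ ≤ ((p : ℝ) * m) ^ m := by
  have hp : 1 < p := (Fact.out : p.Prime).one_lt
  rcases m with _ | m
  · exact ⟨fun _ => n, rfl, by simp [nodeConst]⟩
  -- The order is now $m+1$, and $q$ is the largest power of $p$ with $q(m+1)\le n$; maximality
  -- gives $n<qp(m+1)$.
  set l := Nat.log p (n / (m + 1)) with hl
  set q := p ^ l with hq
  have hq0 : 0 < q := pow_pos (by omega) _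
  have hnm : n / (m + 1) ≠ 0 := (Nat.div_pos h (Nat.succ_pos _)).ne'
  have h1 : q * (m + 1) ≤ n :=
    (Nat.mul_le_mul_right _ (Nat.pow_log_le_self p hnm)).trans (Nat.div_mul_le_self _ _)
  have h2 : n < q * p * (m + 1) := by
    have := Nat.lt_pow_succ_log_self hp (n / (m + 1))
    rw [Nat.div_lt_iff_lt_mul (Nat.succ_pos _)] at this
    rwa [hq, ← pow_succ]
  refine ⟨Fin.cons (n - q * (m + 1)) (fun _ => q - 1), ?_, ?_⟩
  · simp only [nodeTotal, Fin.cons_zero, Fin.tail_cons]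
    rw [add_assoc, add_comm 1, nodeTotal_const m q hq0, mul_comm (m + 1)]
    omega
  · have hd : q ^ (m + 1) ∣
        nodeConst (m + 1) (Fin.cons (n - q * (m + 1)) (fun _ => q - 1)) := by
      simp only [nodeConst, Fin.tail_cons]
      rw [nodeTotal_const m q hq0, pow_succ']
      exact mul_dvd_mul (dvd_mul_left _ _) (nodeConst_const m q hq0)
    obtain ⟨c, hc⟩ := hd
    have hn1 : (1 : ℝ) ≤ n := by exact_mod_cast (by omega : 1 ≤ n)
    have hq' : (0 : ℝ) < q := by exact_mod_cast hq0
    have hnq : ‖(q : ℚ_[p])‖ = (q : ℝ)⁻¹ := by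
      rw [hq]
      push_cast
      rw [norm_pow, Padic.norm_p, inv_pow]
    have hcn : ‖(c : ℚ_[p])‖ ≤ 1 := by simpa using Padic.norm_int_le_one (p := p) (c : ℤ)
    rw [hc, max_eq_right hn1]
    push_cast
    rw [norm_mul, norm_pow, hnq, ← mul_assoc, ← mul_pow]
    refine (mul_le_of_le_one_right (by positivity) hcn).trans ?_
    refine pow_le_pow_left₀ (by positivity) ?_ _
    rw [← div_eq_mul_inv, div_le_iff₀ hq']
    have : (n : ℝ) ≤ q * p * (m + 1) := by exact_mod_cast h2.le
    linarith

end OneDim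

/-! ### Divided differences of binomial polynomials -/

section Choose

variable {p : ℕ} [Fact p.Prime]

/-- The continuous extension of the divided differences of `x ↦ (x choose n)` to `ℤ_p^{1+β}`. -/
def chooseDiff : (β n : ℕ) → (Fin (β + 1) → ℤ_[p]) → ℚ_[p]
  | 0, n, x => (Ring.choose (x 0) n : ℤ_[p])
  | β + 1, n, x => ∑ j ∈ range n, ((j : ℚ_[p]) + 1)⁻¹ *
      ((Ring.choose (x 0) (n - 1 - j) : ℤ_[p]) : ℚ_[p]) *
        chooseDiff β j (fun i => x i.succ - x 0 - 1)

theorem continuous_chooseDiff (β n : ℕ) : Continuous (chooseDiff (p := p) β n) := by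
  induction β generalizing n with
  | zero =>
    simp only [chooseDiff]
    exact continuous_subtype_val.comp ((PadicInt.continuous_choose n).comp (continuous_apply 0))
  | succ β ih =>
    simp only [chooseDiff]
    refine continuous_finsetSum _ fun j _ => ?_
    refine (continuous_const.mul (continuous_subtype_val.comp
      ((PadicInt.continuous_choose _).comp (continuous_apply 0)))).mul ((ih j).comp ?_)
    fun_prop

/-- The left side is the exact power of $p$ dividing $j+1$. -/
theorem norm_inv_natCast_add_one_le (j : ℕ) : ‖((j : ℚ_[p]) + 1)⁻¹‖ ≤ (j : ℝ) + 1 := by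
  rw [norm_inv]
  have hp : 0 < p := (Fact.out : p.Prime).pos
  have h : ‖((j + 1 : ℕ) : ℚ_[p])‖ = ((p : ℝ) ^ padicValNat p (j + 1))⁻¹ := by
    rw [Padic.norm_eq_zpow_neg_valuation (by exact_mod_cast Nat.succ_ne_zero j),
      Padic.valuation_natCast, zpow_neg, zpow_natCast]
  push_cast at h
  rw [h, inv_inv]
  exact_mod_cast Nat.le_of_dvd (Nat.succ_pos j) pow_padicValNat_dvd

/-- Binomials take values in $\mathbb Z_p$, so each recursion step costs only $|1/(j+1)|\le j+1\le
n$. -/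
theorem norm_chooseDiff_le (β n : ℕ) (x : Fin (β + 1) → ℤ_[p]) :
    ‖chooseDiff β n x‖ ≤ (max 1 (n : ℝ)) ^ β := by
  induction β generalizing n with
  | zero => simpa [chooseDiff] using PadicInt.norm_le_one _
  | succ β ih =>
    rw [chooseDiff]
    refine IsUltrametricDist.norm_sum_le_of_forall_le_of_nonneg (by positivity) fun j hj => ?_
    have hjn : (j : ℝ) + 1 ≤ n := by exact_mod_cast mem_range.1 hj
    have hj0 : (0 : ℝ) ≤ j := Nat.cast_nonneg j
    have hn1 : (1 : ℝ) ≤ n := by linarith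
    rw [norm_mul, norm_mul, max_eq_right hn1, pow_succ']
    refine mul_le_mul ?_ ((ih j _).trans ?_) (norm_nonneg _) (Nat.cast_nonneg n)
    · refine (mul_le_of_le_one_right (norm_nonneg _) (PadicInt.norm_le_one _)).trans ?_
      exact (norm_inv_natCast_add_one_le j).trans hjn
    · exact pow_le_pow_left₀ (by positivity) (max_le hn1 (by linarith)) _

/-- Vandermonde for $(z+1)+a$: the term of index $0$ cancels $\binom an$, and
$\binom{z+1}{j+1}/(z+1)=\binom zj/(j+1)$ removes the denominator. -/
theorem choose_add_one_add (a z : ℤ_[p]) (n : ℕ) (hz : z + 1 ≠ 0) :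
    (((Ring.choose (a + 1 + z) n : ℤ_[p]) : ℚ_[p]) - ((Ring.choose a n : ℤ_[p]) : ℚ_[p])) /
      ((z : ℚ_[p]) + 1) =
      ∑ j ∈ range n, ((j : ℚ_[p]) + 1)⁻¹ * ((Ring.choose a (n - 1 - j) : ℤ_[p]) : ℚ_[p]) *
        ((Ring.choose z j : ℤ_[p]) : ℚ_[p]) := by
  have hz' : (z : ℚ_[p]) + 1 ≠ 0 := by
    intro h
    exact hz (Subtype.ext (by push_cast; exact h))
  have h1 : Ring.choose (a + 1 + z) n =
      ∑ j ∈ range (n + 1), Ring.choose (z + 1) j * Ring.choose a (n - j) := by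
    rw [show a + 1 + z = (z + 1) + a by ring, Ring.add_choose_eq n (Commute.all _ _),
      Finset.Nat.sum_antidiagonal_eq_sum_range_succ
        (fun i j => Ring.choose (z + 1) i * Ring.choose a j)]
  have h2 : ∀ j : ℕ, ((j : ℤ_[p]) + 1) * Ring.choose (z + 1) (j + 1) =
      (z + 1) * Ring.choose z j := by
    intro j
    simpa using Ring.choose_add_smul_choose z j 1
  rw [h1, sum_range_succ', Ring.choose_zero_right, one_mul, Nat.sub_zero, div_eq_iff hz', sum_mul]
  rw [PadicInt.coe_add, add_sub_cancel_right, PadicInt.coe_sum]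
  refine sum_congr rfl fun j _ => ?_
  have hj : ((j : ℚ_[p]) + 1) ≠ 0 := Nat.cast_add_one_ne_zero j
  have h3 : ((j : ℚ_[p]) + 1) * ((Ring.choose (z + 1) (j + 1) : ℤ_[p]) : ℚ_[p]) =
      ((z : ℚ_[p]) + 1) * ((Ring.choose z j : ℤ_[p]) : ℚ_[p]) := by
    have := congrArg (fun t : ℤ_[p] => (t : ℚ_[p])) (h2 j)
    push_cast at this
    exact this
  rw [show n - 1 - j = n - (j + 1) by omega, PadicInt.coe_mul, inv_mul_eq_div, div_mul_eq_mul_div,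
    div_mul_eq_mul_div, eq_div_iff hj]
  linear_combination ((Ring.choose a (n - (j + 1)) : ℤ_[p]) : ℚ_[p]) * h3

theorem chooseDiff_eq_dividedDiff (β n : ℕ) {x : Fin (β + 1) → ℤ_[p]}
    (hx : Function.Injective x) :
    chooseDiff β n x = dividedDiff (fun j => (x j : ℚ_[p]))
      (fun j => ((Ring.choose (x j) n : ℤ_[p]) : ℚ_[p])) := by
  induction β generalizing n with
  | zero => simp [chooseDiff, dividedDiff]
  | succ β ih =>
    rw [dividedDiff_succ (v := fun j => (x j : ℚ_[p])) (Subtype.val_injective.comp hx),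
      chooseDiff]
    have h1 : ∀ j : Fin (β + 1),
        (((Ring.choose (x j.succ) n : ℤ_[p]) : ℚ_[p]) - ((Ring.choose (x 0) n : ℤ_[p]) : ℚ_[p])) /
          ((x j.succ : ℚ_[p]) - (x 0 : ℚ_[p])) =
        ∑ i ∈ range n, ((i : ℚ_[p]) + 1)⁻¹ * ((Ring.choose (x 0) (n - 1 - i) : ℤ_[p]) : ℚ_[p]) *
          ((Ring.choose (x j.succ - x 0 - 1) i : ℤ_[p]) : ℚ_[p]) := by
      intro j
      have h := choose_add_one_add (x 0) (x j.succ - x 0 - 1) n (by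
        rw [sub_add_cancel, sub_ne_zero]
        exact fun h => Fin.succ_ne_zero j (hx h))
      rw [show x 0 + 1 + (x j.succ - x 0 - 1) = x j.succ by ring] at h
      rw [← h]
      congr 1
      push_cast
      ring
    simp only [h1]
    rw [dividedDiff_sum]
    refine sum_congr rfl fun i _ => ?_
    rw [ih i (fun a b h => Fin.succ_injective _ (hx (by simpa using h)))]
    rw [← dividedDiff_add_const (fun j => ((x j.succ - x 0 - 1 : ℤ_[p]) : ℚ_[p])) _
      ((x 0 : ℚ_[p]) + 1)]
    congr 2
    ext j
    simp only [Fin.tail]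
    push_cast
    ring

end Choose

/-! ### Continuous ultrametric seminorms -/

section Seminorms

variable {E : Type*} [AddCommGroup E]

theorem seminorm_sum_le {K ι : Type*} [NormedField K] [Module K E] (q : Seminorm K E)
    (hq : IsNonarchimedean q) {s : Finset ι} {f : ι → E} {C : ℝ} (hC : 0 ≤ C)
    (h : ∀ i ∈ s, q (f i) ≤ C) : q (∑ i ∈ s, f i) ≤ C := by
  classical
  induction s using Finset.induction_on with
  | empty => simpa using hC
  | insert a s ha ih =>
    rw [sum_insert ha]
    exact (hq _ _).trans (max_le (h a (mem_insert_self a s))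
      (ih fun i hi => h i (mem_insert_of_mem hi)))

theorem seminorm_sum_lt {K ι : Type*} [NormedField K] [Module K E] (q : Seminorm K E)
    (hq : IsNonarchimedean q) {s : Finset ι} {f : ι → E} {C : ℝ} (hC : 0 < C)
    (h : ∀ i ∈ s, q (f i) < C) : q (∑ i ∈ s, f i) < C := by
  classical
  induction s using Finset.induction_on with
  | empty => simpa using hC
  | insert a s ha ih =>
    rw [sum_insert ha]
    exact (hq _ _).trans_lt (max_lt (h a (mem_insert_self a s))
      (ih fun i hi => h i (mem_insert_of_mem hi)))

theorem seminorm_sub_le {K : Type*} [NormedField K] [Module K E] (q : Seminorm K E)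
    (hq : IsNonarchimedean q) (x y : E) : q (x - y) ≤ max (q x) (q y) := by
  rw [sub_eq_add_neg]
  simpa using hq x (-y)

variable {p : ℕ} [Fact p.Prime] [Module ℚ_[p] E]

/-- The gauge of an additive subgroup of a vector space over `ℚ_p`. -/
def padicGauge (S : AddSubgroup E) (x : E) : ℝ :=
  sInf ((fun a : ℚ_[p] => ‖a‖) '' {a | a ≠ 0 ∧ a⁻¹ • x ∈ S})

variable {S : AddSubgroup E}

theorem padicGauge_le {x : E} {a : ℚ_[p]} (ha : a ≠ 0) (hx : a⁻¹ • x ∈ S) :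
    padicGauge (p := p) S x ≤ ‖a‖ :=
  csInf_le ⟨0, by rintro _ ⟨a, _, rfl⟩; exact norm_nonneg a⟩ ⟨a, ⟨ha, hx⟩, rfl⟩

theorem padicGauge_nonneg (x : E) : 0 ≤ padicGauge (p := p) S x :=
  Real.sInf_nonneg (by rintro _ ⟨a, _, rfl⟩; exact norm_nonneg a)

theorem padicGauge_zero : padicGauge (p := p) S (0 : E) = 0 := by
  refine le_antisymm (le_of_forall_gt fun r hr => ?_) (padicGauge_nonneg _)
  obtain ⟨a, ha, har⟩ := NormedField.exists_norm_lt ℚ_[p] hr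
  exact (padicGauge_le (norm_pos_iff.1 ha) (by simp)).trans_lt har

variable [TopologicalSpace E] [ContinuousSMul ℚ_[p] E]

theorem exists_norm_lt_of_padicGauge_lt (hS : (S : Set E) ∈ 𝓝 0) {x : E} {r : ℝ}
    (h : padicGauge (p := p) S x < r) : ∃ a : ℚ_[p], a ≠ 0 ∧ a⁻¹ • x ∈ S ∧ ‖a‖ < r := by
  have hne : ((fun a : ℚ_[p] => ‖a‖) '' {a | a ≠ 0 ∧ a⁻¹ • x ∈ S}).Nonempty := by
    have h0 : Tendsto (fun k : ℕ => (p : ℚ_[p]) ^ k • x) atTop (𝓝 ((0 : ℚ_[p]) • x)) :=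
      (tendsto_pow_atTop_nhds_zero_of_norm_lt_one Padic.norm_p_lt_one).smul_const x
    rw [zero_smul] at h0
    obtain ⟨k, hk⟩ := (h0.eventually hS).exists
    have hp : (p : ℚ_[p]) ≠ 0 := Nat.cast_ne_zero.2 (Fact.out : p.Prime).ne_zero
    exact ⟨_, ((p : ℚ_[p]) ^ k)⁻¹, ⟨inv_ne_zero (pow_ne_zero _ hp), by rw [inv_inv]; exact hk⟩, rfl⟩
  obtain ⟨_, ⟨a, ⟨ha, hx⟩, rfl⟩, hr⟩ := exists_lt_of_csInf_lt hne h
  exact ⟨a, ha, hx, hr⟩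

theorem padicGauge_add_le (hS : (S : Set E) ∈ 𝓝 0)
    (hS' : ∀ a : ℚ_[p], ‖a‖ ≤ 1 → ∀ x ∈ S, a • x ∈ S) (x y : E) :
    padicGauge (p := p) S (x + y) ≤ max (padicGauge (p := p) S x) (padicGauge (p := p) S y) := by
  refine le_of_forall_gt fun r hr => ?_
  obtain ⟨a, ha, hx, har⟩ := exists_norm_lt_of_padicGauge_lt hS ((le_max_left _ _).trans_lt hr)
  obtain ⟨b, hb, hy, hbr⟩ := exists_norm_lt_of_padicGauge_lt hS ((le_max_right _ _).trans_lt hr)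
  have key : ∀ {c d : ℚ_[p]} {z : E}, c ≠ 0 → d ≠ 0 → ‖c‖ ≤ ‖d‖ → c⁻¹ • z ∈ S → d⁻¹ • z ∈ S := by
    intro c d z hc hd hcd hz
    have := hS' (d⁻¹ * c) (by
      rw [norm_mul, norm_inv, inv_mul_le_iff₀ (norm_pos_iff.2 hd), mul_one]
      exact hcd) _ hz
    rwa [smul_smul, mul_assoc, mul_inv_cancel₀ hc, mul_one] at this
  rcases le_total ‖a‖ ‖b‖ with h | h
  · refine (padicGauge_le hb ?_).trans_lt hbr
    rw [smul_add]
    exact S.add_mem (key ha hb h hx) hy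
  · refine (padicGauge_le ha ?_).trans_lt har
    rw [smul_add]
    exact S.add_mem hx (key hb ha h hy)

theorem padicGauge_smul_le (hS : (S : Set E) ∈ 𝓝 0) (c : ℚ_[p]) (x : E) :
    padicGauge (p := p) S (c • x) ≤ ‖c‖ * padicGauge (p := p) S x := by
  rcases eq_or_ne c 0 with rfl | hc
  · simp [padicGauge_zero]
  rw [← div_le_iff₀' (norm_pos_iff.2 hc)]
  refine le_of_forall_gt fun r hr => ?_
  obtain ⟨a, ha, hx, har⟩ := exists_norm_lt_of_padicGauge_lt hS hr
  refine lt_of_le_of_lt ?_ har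
  rw [div_le_iff₀' (norm_pos_iff.2 hc), ← norm_mul]
  refine padicGauge_le (mul_ne_zero hc ha) ?_
  rwa [smul_smul, mul_inv, mul_comm c⁻¹, mul_assoc, inv_mul_cancel₀ hc, mul_one]

variable [IsTopologicalAddGroup E]

/-- The gauge of an open $\mathbb Z_p$-submodule $S\subseteq W$ is ultrametric. It is at most $1$ on
$S$, hence continuous, and its open unit ball lies in $S$. -/
theorem exists_contUltraSeminorm (hconv : IsUltraLocallyConvex ℚ_[p] E) {W : Set E}
    (hW : W ∈ 𝓝 0) : ∃ q : ContUltraSeminorm ℚ_[p] E, ∀ x, q.1 x < 1 → x ∈ W := by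
  obtain ⟨S, ⟨hSo, hS'⟩, hSW⟩ := hconv.mem_iff.1 hW
  have hS : (S : Set E) ∈ 𝓝 0 := hSo.mem_nhds S.zero_mem
  let q : Seminorm ℚ_[p] E := Seminorm.ofSMulLE (padicGauge (p := p) S) padicGauge_zero
    (fun x y => (padicGauge_add_le hS hS' x y).trans
      (max_le_add_of_nonneg (padicGauge_nonneg x) (padicGauge_nonneg y)))
    (padicGauge_smul_le hS)
  refine ⟨⟨q, ?_, padicGauge_add_le hS hS'⟩, fun x hx => hSW ?_⟩
  · refine Seminorm.continuous' (r := 1) (mem_of_superset hS fun x hx => ?_)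
    rw [Seminorm.mem_closedBall_zero]
    have := padicGauge_le (p := p) (a := 1) one_ne_zero (by simpa using hx)
    rwa [norm_one] at this
  · obtain ⟨a, ha, hx', har⟩ := exists_norm_lt_of_padicGauge_lt (p := p) hS hx
    have := hS' a har.le _ hx'
    rwa [smul_smul, mul_inv_cancel₀ ha, one_smul] at this

end Seminorms

/-! ### Uniformly convergent series -/

section Series

variable {p : ℕ} [Fact p.Prime] {E : Type*} [AddCommGroup E] [Module ℚ_[p] E] [UniformSpace E]
  [IsUniformAddGroup E] [ContinuousSMul ℚ_[p] E]

theorem exists_contUltraSeminorm_uniformity (hconv : IsUltraLocallyConvex ℚ_[p] E)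
    {u : Set (E × E)} (hu : u ∈ uniformity E) :
    ∃ q : ContUltraSeminorm ℚ_[p] E, ∀ x y, q.1 (y - x) < 1 → (x, y) ∈ u := by
  rw [uniformity_eq_comap_nhds_zero E, mem_comap] at hu
  obtain ⟨W, hW, hWu⟩ := hu
  obtain ⟨q, hq⟩ := exists_contUltraSeminorm hconv hW
  exact ⟨q, fun x y h => hWu (hq _ h)⟩

/-- By the ultrametric inequality, small terms outside a finite set give small partial sums there,
uniformly in $x$. Summing over a sequence of boxes makes sequential completeness sufficient. -/
theorem exists_tendstoUniformly_sum (hconv : IsUltraLocallyConvex ℚ_[p] E)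
    (hcomplete : ∀ u : ℕ → E, CauchySeq u → ∃ a : E, Tendsto u atTop (𝓝 a))
    {X Y : Type*} {w : Y → Set.Ioi (0 : ℝ)} (b : CZeroSpace ℚ_[p] E w) {κ : X → Y → ℚ_[p]}
    (hκ : ∀ x y, ‖κ x y‖ ≤ w y) {box : ℕ → Finset Y} (hbox : Tendsto box atTop atTop) :
    ∃ g : X → E, TendstoUniformly (fun N x => ∑ y ∈ box N, κ x y • b y) g atTop ∧
      ∀ (q : ContUltraSeminorm ℚ_[p] E) x, q.1 (g x) ≤ cZeroSeminorm w q b := by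
  classical
  have hq_le : ∀ (q : ContUltraSeminorm ℚ_[p] E) x y, q.1 (κ x y • b y) ≤ w y * q.1 (b y) := by
    intro q x y
    rw [map_smul_eq_mul]
    exact mul_le_mul_of_nonneg_right (hκ x y) (apply_nonneg _ _)
  have hC : UniformCauchySeqOn (fun N x => ∑ y ∈ box N, κ x y • b y) atTop Set.univ := by
    intro u hu
    obtain ⟨q, hq⟩ := exists_contUltraSeminorm_uniformity hconv hu
    obtain ⟨Φ, hΦ⟩ := b.2 q 1 one_pos
    have hev := hbox.eventually (eventually_ge_atTop Φ)
    filter_upwards [hev.prod_mk hev] with N hN x _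
    refine hq _ _ ?_
    have hT : ∀ s : Finset Y, q.1 (∑ y ∈ s \ Φ, κ x y • b y) < 1 := fun s =>
      seminorm_sum_lt q.1 q.2.2 one_pos fun y hy =>
        (hq_le q x y).trans_lt (hΦ y (mem_sdiff.1 hy).2)
    rw [← sum_sdiff hN.1, ← sum_sdiff hN.2, add_sub_add_right_eq_sub]
    exact (seminorm_sub_le q.1 q.2.2 _ _).trans_lt (max_lt (hT _) (hT _))
  have hx : ∀ x, ∃ a, Tendsto (fun N => ∑ y ∈ box N, κ x y • b y) atTop (𝓝 a) := fun x =>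
    hcomplete _ (hC.cauchySeq (Set.mem_univ x))
  choose g hg using hx
  refine ⟨g, tendstoUniformlyOn_univ.1 (hC.tendstoUniformlyOn_of_tendsto fun x _ => hg x),
    fun q x => ?_⟩
  refine le_of_tendsto ((q.2.1.tendsto _).comp (hg x)) (Eventually.of_forall fun N => ?_)
  exact seminorm_sum_le q.1 q.2.2 (apply_nonneg _ _) fun y _ =>
    (hq_le q x y).trans (le_ciSup (CZeroSpace.bddAbove q b) y)

theorem tendsto_Iic_const_atTop (ι : Type*) [Fintype ι] [DecidableEq ι] :
    Tendsto (fun N : ℕ => (Iic (fun _ => N) : Finset (ι → ℕ))) atTop atTop := by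
  refine tendsto_atTop_finset_of_monotone (fun M N h => Iic_subset_Iic.2 fun _ => h) fun ν => ?_
  refine ⟨∑ i, ν i, mem_Iic.2 fun i => single_le_sum (f := ν) (fun _ _ => Nat.zero_le _)
    (mem_univ i)⟩

end Series

/-! ### Density of the points with distinct entries -/

section Density

theorem exists_injective_mem_of_infinite {K : Type*} (m : ℕ) (T : Fin m → Set K)
    (hT : ∀ j, (T j).Infinite) : ∃ y : Fin m → K, Function.Injective y ∧ ∀ j, y j ∈ T j := by
  induction m with
  | zero => exact ⟨Fin.elim0, fun a => a.elim0, fun a => a.elim0⟩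
  | succ m ih =>
    obtain ⟨y, hy, hyT⟩ := ih (fun j => T j.succ) fun j => hT _
    obtain ⟨a, ha, hay⟩ := ((hT 0).sdiff (Set.finite_range y)).nonempty
    exact ⟨Fin.cons a y, Fin.cons_injective_iff.2 ⟨hay, hy⟩, fun j => Fin.cases ha hyT j⟩

theorem mem_of_mem_extDomain_pi {n : ℕ} {K : Type*} {S : Fin n → Set K} {β : Fin n → ℕ}
    {x : (i : Fin n) → Fin (β i + 1) → K} (hx : x ∈ extDomain (Set.pi Set.univ S) β)
    (i : Fin n) (j : Fin (β i + 1)) : x i j ∈ S i := by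
  have := hx (Function.update (fun _ => 0) i j) i (Set.mem_univ i)
  simpa using this

variable {n : ℕ} {K : Type*} [NormedField K]

/-- Without isolated points, every ball about an entry meets the factor in an infinite set, so the
entries can be perturbed one by one to be distinct. -/
theorem dense_injective_extDomain {V : Set (Fin n → K)} (hV : IsCartesian V) (β : Fin n → ℕ) :
    Dense {x : extDomain V β | ∀ i, Function.Injective (x.1 i)} := by
  obtain ⟨S, hS, rfl⟩ := hV
  intro x
  rw [Metric.mem_closure_iff]
  intro ε hε
  have h : ∀ i, ∃ y : Fin (β i + 1) → K, Function.Injective y ∧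
      ∀ j, y j ∈ Metric.ball (x.1 i j) ε ∩ S i := fun i =>
    exists_injective_mem_of_infinite _ _ fun j => Set.Infinite.of_accPt
      ((hS i _ (mem_of_mem_extDomain_pi x.2 i j)).nhds_inter (Metric.ball_mem_nhds _ hε))
  choose y hy hyS using h
  refine ⟨⟨y, fun j i _ => (hyS i (j i)).2⟩, hy, ?_⟩
  rw [Subtype.dist_eq, dist_pi_lt_iff hε]
  intro i
  rw [dist_pi_lt_iff hε]
  intro j
  rw [dist_comm]
  exact (hyS i j).1

theorem IsContExtension.unique {E : Type*} [AddCommGroup E] [Module K E] [TopologicalSpace E]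
    [T2Space E] {V : Set (Fin n → K)} (hV : IsCartesian V) {f : V → E} {β : Fin n → ℕ}
    {g g' : extDomain V β → E} (hg : IsContExtension f β g) (hg' : IsContExtension f β g') :
    g = g' :=
  hg.1.ext_on (dense_injective_extDomain hV β) hg'.1 fun x hx => (hg.2 x hx).trans (hg'.2 x hx).symm

end Density

/-! ### Mahler coefficients in several variables -/

section MultiMahler

variable {ι : Type*} [Fintype ι] [DecidableEq ι]

theorem Iic_eq_piFinset {κ : ι → Type*} [∀ i, PartialOrder (κ i)]
    [∀ i, LocallyFiniteOrderBot (κ i)] [LocallyFiniteOrderBot ((i : ι) → κ i)] (m : (i : ι) → κ i) :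
    Iic m = Fintype.piFinset fun i => Iic (m i) := by
  ext k
  simp [Pi.le_def]

theorem sum_smul_eq_sum_fiber {K E C Y : Type*} [Field K] [AddCommGroup E] [Module K E]
    [DecidableEq Y] (u : Finset C) (c : C → K) (χ : C → Y) {T : Finset Y} (hT : u.image χ ⊆ T)
    (f : Y → E) :
    ∑ x ∈ u, c x • f (χ x) = ∑ y ∈ T, (∑ x ∈ u, c x * (if χ x = y then 1 else 0)) • f y := by
  simp only [sum_smul]
  rw [sum_comm]
  refine sum_congr rfl fun x hx => ?_
  rw [sum_eq_single (χ x)]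
  · simp
  · intro y _ hy
    simp [hy.symm]
  · intro hn
    exact absurd (hT (mem_image_of_mem χ hx)) hn

/-- A linear identity between values of an arbitrary function need only be checked on scalar
indicators of points; this carries scalar identities over to $E$. -/
theorem sum_eq_sum_of_forall_single {K E A B Y : Type*} [Field K] [AddCommGroup E] [Module K E]
    [DecidableEq Y] (s : Finset A) (t : Finset B) (a : A → K) (φ : A → Y) (b : B → K) (ψ : B → Y)
    (h : ∀ y, ∑ x ∈ s, a x * (if φ x = y then 1 else 0) =
      ∑ x ∈ t, b x * (if ψ x = y then 1 else 0)) (f : Y → E) :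
    ∑ x ∈ s, a x • f (φ x) = ∑ x ∈ t, b x • f (ψ x) := by
  rw [sum_smul_eq_sum_fiber s a φ (subset_union_left (s₂ := t.image ψ)),
    sum_smul_eq_sum_fiber t b ψ (subset_union_right (s₁ := s.image φ))]
  exact sum_congr rfl fun y _ => by rw [h y]

variable {p : ℕ} [Fact p.Prime] {E : Type*} [AddCommGroup E] [Module ℚ_[p] E]

variable (p) in
/-- The Mahler coefficients of a function of several natural numbers. -/
def multiMahler (G : (ι → ℕ) → E) (m : ι → ℕ) : E :=
  ∑ k ∈ Iic m, (∏ i, mahlerEntry ℚ_[p] (m i) (k i)) • G k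

theorem norm_mahlerEntry_le_one (n k : ℕ) : ‖mahlerEntry ℚ_[p] n k‖ ≤ 1 := by
  rw [mahlerEntry, norm_mul, norm_pow, norm_neg, norm_one, one_pow, one_mul]
  simpa using Padic.norm_int_le_one (p := p) (n.choose k : ℤ)

theorem norm_prod_mahlerEntry_le_one {κ : Type*} [Fintype κ] (m k : κ → ℕ) :
    ‖∏ i, mahlerEntry ℚ_[p] (m i) (k i)‖ ≤ 1 := by
  rw [norm_prod]
  exact prod_le_one (fun _ _ => norm_nonneg _) fun _ _ => norm_mahlerEntry_le_one _ _

theorem multiMahler_le (q : Seminorm ℚ_[p] E) (hq : IsNonarchimedean q) {G : (ι → ℕ) → E} {C : ℝ}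
    (hC : 0 ≤ C) (h : ∀ k, q (G k) ≤ C) (m : ι → ℕ) : q (multiMahler p G m) ≤ C := by
  refine seminorm_sum_le q hq hC fun k _ => ?_
  rw [map_smul_eq_mul]
  exact (mul_le_of_le_one_left (apply_nonneg _ _) (norm_prod_mahlerEntry_le_one m k)).trans (h k)

theorem multiMahler_lt (q : Seminorm ℚ_[p] E) (hq : IsNonarchimedean q) {G : (ι → ℕ) → E} {C : ℝ}
    (hC : 0 < C) (h : ∀ k, q (G k) < C) (m : ι → ℕ) : q (multiMahler p G m) < C := by
  refine seminorm_sum_lt q hq hC fun k _ => ?_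
  rw [map_smul_eq_mul]
  exact (mul_le_of_le_one_left (apply_nonneg _ _) (norm_prod_mahlerEntry_le_one m k)).trans_lt (h k)

theorem sum_prod_mahlerEntry_mul (g : ι → ℕ → ℚ_[p]) (m : ι → ℕ) :
    ∑ k ∈ Iic m, (∏ i, mahlerEntry ℚ_[p] (m i) (k i)) * ∏ i, g i (k i) =
      ∏ i, ∑ a ∈ Iic (m i), mahlerEntry ℚ_[p] (m i) a * g i a := by
  rw [Finset.prod_univ_sum, Iic_eq_piFinset]
  simp only [prod_mul_distrib]

variable (p) in
/-- The Mahler coefficients of the indicator function of a residue class modulo `p ^ s`. -/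
def residueMahler (s r n : ℕ) : ℚ_[p] :=
  ∑ k ∈ Iic n, mahlerEntry ℚ_[p] n k * if k % p ^ s = r then 1 else 0

theorem norm_residueMahler_le_one (s r n : ℕ) : ‖residueMahler p s r n‖ ≤ 1 := by
  refine IsUltrametricDist.norm_sum_le_of_forall_le_of_nonneg zero_le_one fun k _ => ?_
  rw [norm_mul]
  refine mul_le_one₀ (norm_mahlerEntry_le_one _ _) (norm_nonneg _) ?_
  split_ifs <;> simp

open scoped Classical in
-- The classical Mahler theorem, applied to the indicator of the clopen ball $r+p^s\mathbb Z_p$.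
theorem tendsto_residueMahler {s r : ℕ} (hr : r < p ^ s) :
    Tendsto (residueMahler p s r) atTop (𝓝 0) := by
  let B : Set ℤ_[p] := Metric.closedBall (r : ℤ_[p]) ((p : ℝ) ^ (-(s : ℤ)))
  have hp : (p : ℝ) ≠ 0 := Nat.cast_ne_zero.2 (Fact.out : p.Prime).ne_zero
  have hB : IsClopen B := IsUltrametricDist.isClopen_closedBall _ (zpow_ne_zero _ hp)
  let f : C(ℤ_[p], ℤ_[p]) := ⟨B.indicator fun _ => 1, hB.continuous_indicator continuous_const⟩
  have hf : ∀ k : ℕ, (f (k : ℤ_[p]) : ℤ_[p]) = if k % p ^ s = r then 1 else 0 := by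
    intro k
    have hk : (k : ℤ_[p]) ∈ B ↔ k % p ^ s = r := by
      rw [Metric.mem_closedBall, dist_eq_norm]
      have : (k : ℤ_[p]) - (r : ℤ_[p]) = ((k - r : ℤ) : ℤ_[p]) := by push_cast; rfl
      rw [this, PadicInt.norm_int_le_pow_iff_dvd, ← Nat.cast_pow, ← Nat.modEq_iff_dvd, Nat.ModEq,
        Nat.mod_eq_of_lt hr, eq_comm]
    change B.indicator (fun _ => 1) _ = _
    rw [Set.indicator_apply]
    simp only [hk]
  have h := PadicInt.fwdDiff_tendsto_zero f
  have h' : Tendsto (fun n => (((fwdDiff 1)^[n] f 0 : ℤ_[p]) : ℚ_[p])) atTop (𝓝 0) :=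
    (continuous_subtype_val.tendsto (0 : ℤ_[p])).comp h
  refine h'.congr fun n => ?_
  rw [fwdDiff_iter_eq_sum_shift, residueMahler, ← Nat.range_succ_eq_Iic, PadicInt.coe_sum]
  refine sum_congr rfl fun k _ => ?_
  rw [zero_add, nsmul_one, hf, mahlerEntry]
  split_ifs <;> simp

/-- Replace $G$ by a function periodic modulo $p^s$: the error stays below $\varepsilon$ because
Mahler entries are integers. The periodic function is a finite combination of products of residue
class indicators, whose coefficients decay in each variable. -/
theorem finite_le_multiMahler (q : Seminorm ℚ_[p] E) (hq : IsNonarchimedean q) {G : (ι → ℕ) → E}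
    (hG : ∀ ε > 0, ∃ s : ℕ, ∀ k k', (∀ i, k i ≡ k' i [MOD p ^ s]) → q (G k - G k') < ε)
    {ε : ℝ} (hε : 0 < ε) : {m | ε ≤ q (multiMahler p G m)}.Finite := by
  obtain ⟨s, hs⟩ := hG ε hε
  set R : Finset (ι → ℕ) := Fintype.piFinset fun _ => range (p ^ s) with hR
  have hps : 0 < p ^ s := pow_pos (Fact.out : p.Prime).pos _
  have h1 : ∀ m, multiMahler p (fun k => G fun i => k i % p ^ s) m =
      ∑ r ∈ R, (∏ i, residueMahler p s (r i) (m i)) • G r := by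
    intro m
    have h2 : ∀ r : ι → ℕ, ∏ i, residueMahler p s (r i) (m i) =
        ∑ k ∈ Iic m, (∏ i, mahlerEntry ℚ_[p] (m i) (k i)) *
          if (fun i => k i % p ^ s) = r then 1 else 0 := by
      intro r
      simp only [residueMahler]
      rw [← sum_prod_mahlerEntry_mul (fun i k => if k % p ^ s = r i then 1 else 0)]
      refine sum_congr rfl fun k _ => ?_
      congr 1
      rw [Fintype.prod_boole]
      simp only [funext_iff]
    simp only [h2, sum_smul]
    rw [sum_comm]
    refine sum_congr rfl fun k _ => ?_
    rw [sum_eq_single fun i => k i % p ^ s]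
    · simp
    · intro r _ hr
      simp [hr.symm]
    · intro hn
      exact absurd (Fintype.mem_piFinset.2 fun i => mem_range.2 (Nat.mod_lt _ hps)) hn
  obtain ⟨C, hC0, hC⟩ : ∃ C : ℝ, 0 < C ∧ ∀ r ∈ R, q (G r) ≤ C :=
    ⟨1 + ∑ r ∈ R, q (G r), by positivity, fun r hr =>
      (single_le_sum (f := fun r => q (G r)) (fun _ _ => apply_nonneg _ _) hr).trans
        (le_add_of_nonneg_left zero_le_one)⟩
  have hN : ∀ᶠ N in atTop, ∀ r ∈ range (p ^ s), ∀ n ≥ N, ‖residueMahler p s r n‖ < ε / C := by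
    rw [eventually_all_finset]
    intro r hr
    have := (tendsto_residueMahler (p := p) (mem_range.1 hr)).norm
    rw [norm_zero] at this
    change Tendsto (fun n => ‖residueMahler p s r n‖) atTop (𝓝 0) at this
    exact eventually_forall_ge_atTop.2 (this.eventually (gt_mem_nhds (div_pos hε hC0)))
  obtain ⟨N, hN⟩ := hN.exists
  refine (finite_toSet (Iic fun _ : ι => N)).subset fun m hm => ?_
  rw [mem_coe, mem_Iic]
  by_contra hmN
  obtain ⟨i, hi⟩ := not_forall.1 hmN
  refine absurd (Set.mem_ofPred.1 hm) (not_le.2 ?_)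
  have hsplit : multiMahler p G m = multiMahler p (fun k => G k - G fun i => k i % p ^ s) m +
      multiMahler p (fun k => G fun i => k i % p ^ s) m := by
    simp only [multiMahler, smul_sub, sum_sub_distrib, sub_add_cancel]
  rw [hsplit]
  refine (hq _ _).trans_lt (max_lt ?_ ?_)
  · exact multiMahler_lt q hq hε (fun k => hs _ _ fun i => (Nat.mod_modEq _ _).symm) m
  · rw [h1]
    refine seminorm_sum_lt q hq hε fun r hr => ?_
    rw [map_smul_eq_mul, norm_prod]
    have hri := Fintype.mem_piFinset.1 hr
    have hlt : ∏ i, ‖residueMahler p s (r i) (m i)‖ < ε / C := by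
      rw [← mul_prod_erase _ _ (mem_univ i)]
      refine (mul_le_of_le_one_right (norm_nonneg _) ?_).trans_lt
        (hN _ (hri i) _ (not_le.1 hi).le)
      exact prod_le_one (fun _ _ => norm_nonneg _) fun _ _ => norm_residueMahler_le_one _ _ _
    calc _ ≤ (∏ i, ‖residueMahler p s (r i) (m i)‖) * C :=
          mul_le_mul_of_nonneg_left (hC r hr) (prod_nonneg fun _ _ => norm_nonneg _)
      _ < ε / C * C := mul_lt_mul_of_pos_right hlt hC0
      _ = ε := div_mul_cancel₀ _ hC0.ne'

end MultiMahler

/-! ### Mahler coefficients expressed by iterated partial difference quotients -/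

section Nodes

variable {ι : Type*} [Fintype ι] [DecidableEq ι] {p : ℕ} [Fact p.Prime] {E : Type*}
  [AddCommGroup E] [Module ℚ_[p] E]

/-- It suffices to test indicators of points. These are products over the coordinates, so both sides
factor into instances of `sum_dividedDiff_nodes`. -/
theorem multiMahler_nodeTotal (f : (ι → ℕ) → E) {β : ι → ℕ} (idx : (i : ι) → Fin (β i + 1) → ℕ) :
    multiMahler p f (fun i => nodeTotal (β i) (idx i)) =
      (∏ i, (nodeConst (β i) (idx i) : ℚ_[p])) • ∑ μ ∈ Iic idx,
        (∏ i, ∏ k, mahlerEntry ℚ_[p] (idx i k) (μ i k)) •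
          ∑ j : (i : ι) → Fin (β i + 1), (∏ i, ∏ k ∈ univ.erase (j i),
            ((nodes (β i) (μ i) (j i) : ℚ_[p]) - (nodes (β i) (μ i) k : ℚ_[p]))⁻¹) •
              f (fun i => nodes (β i) (μ i) (j i)) := by
  simp only [smul_sum, smul_smul]
  rw [← sum_product']
  refine sum_eq_sum_of_forall_single (Iic fun i => nodeTotal (β i) (idx i)) _ _ id _
    (fun x : ((i : ι) → Fin (β i + 1) → ℕ) × ((i : ι) → Fin (β i + 1)) =>
      fun i => nodes (β i) (x.1 i) (x.2 i)) (fun y => ?_) f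
  have hδ : ∀ k : ι → ℕ, (if k = y then (1 : ℚ_[p]) else 0) = ∏ i, if k i = y i then 1 else 0 := by
    intro k
    rw [Fintype.prod_boole]
    simp only [funext_iff]
  simp only [hδ, id_eq]
  rw [sum_prod_mahlerEntry_mul (fun i a => if a = y i then 1 else 0)]
  have h1 : ∀ i, ∑ a ∈ Iic (nodeTotal (β i) (idx i)),
      mahlerEntry ℚ_[p] (nodeTotal (β i) (idx i)) a * (if a = y i then 1 else 0) =
      (nodeConst (β i) (idx i) : ℚ_[p]) * ∑ μ ∈ Iic (idx i),
        (∏ k, mahlerEntry ℚ_[p] (idx i k) (μ k)) *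
          ∑ j, (∏ k ∈ univ.erase j, ((nodes (β i) μ j : ℚ_[p]) - (nodes (β i) μ k : ℚ_[p]))⁻¹) *
            (if nodes (β i) μ j = y i then 1 else 0) := by
    intro i
    have h2 := sum_dividedDiff_nodes (K := ℚ_[p]) (β i) (idx i) (fun a => if a = y i then 1 else 0)
    have hc : (nodeConst (β i) (idx i) : ℚ_[p]) ≠ 0 := Nat.cast_ne_zero.2 (nodeConst_ne_zero _ _)
    rw [eq_inv_mul_iff_mul_eq₀ hc] at h2
    rw [← h2]
    rfl
  rw [prod_congr rfl fun i _ => h1 i, prod_mul_distrib, Finset.prod_univ_sum, ← Iic_eq_piFinset,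
    mul_sum, sum_product]
  refine sum_congr rfl fun μ _ => ?_
  rw [prod_mul_distrib, Finset.prod_univ_sum, Fintype.piFinset_univ, mul_sum, mul_sum]
  refine sum_congr rfl fun j _ => ?_
  rw [prod_mul_distrib]
  ring

end Nodes

/-! ### The domains `V^{<β>}` for subsets of `ℤ_pⁿ` -/

section Domain

variable {p : ℕ} [Fact p.Prime] {n : ℕ}

theorem zpPow_eq_pi : zpPow p n = Set.pi Set.univ fun _ => Metric.closedBall (0 : ℚ_[p]) 1 := by
  ext x
  simp [zpPow]

theorem isOpenCartesianIn_zpPow : IsOpenCartesianIn (zpPow p n) (zpPow p n) where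
  subset := subset_rfl
  isCartesian := ⟨fun _ => Metric.closedBall 0 1,
    fun _ => (IsUltrametricDist.isOpen_closedBall _ one_ne_zero).preperfect, zpPow_eq_pi⟩
  isOpen := ⟨Set.univ, isOpen_univ, (Set.inter_univ _).symm⟩

theorem norm_le_one_of_mem_extDomain {V : Set (Fin n → ℚ_[p])} (hV : V ⊆ zpPow p n)
    {β : Fin n → ℕ} {x : (i : Fin n) → Fin (β i + 1) → ℚ_[p]} (hx : x ∈ extDomain V β)
    (i : Fin n) (j : Fin (β i + 1)) : ‖x i j‖ ≤ 1 := by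
  have hx' : x ∈ extDomain (Set.pi Set.univ fun _ => Metric.closedBall (0 : ℚ_[p]) 1) β :=
    fun j => zpPow_eq_pi (p := p) (n := n) ▸ hV (hx j)
  simpa using mem_of_mem_extDomain_pi hx' i j

instance compactSpace_extDomain_zpPow (β : Fin n → ℕ) : CompactSpace (extDomain (zpPow p n) β) := by
  rw [← isCompact_iff_compactSpace]
  have h : extDomain (zpPow p n) β =
      Set.pi Set.univ fun i => Set.pi Set.univ fun _ : Fin (β i + 1) =>
        Metric.closedBall (0 : ℚ_[p]) 1 := by
    ext x
    refine ⟨fun hx i _ j _ => ?_, fun hx j i => ?_⟩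
    · simpa using norm_le_one_of_mem_extDomain subset_rfl hx i j
    · simpa using hx i (Set.mem_univ i) (j i) (Set.mem_univ _)
  rw [h]
  exact isCompact_univ_pi fun i => isCompact_univ_pi fun _ => isCompact_closedBall _ _

variable (p) in
/-- The point of `(ℤ_pⁿ)^{<β>}` formed by the nodes with prescribed gaps. -/
def nodePoint (β : Fin n → ℕ) (μ : (i : Fin n) → Fin (β i + 1) → ℕ) :
    extDomain (zpPow p n) β :=
  ⟨fun i j => (nodes (β i) (μ i) j : ℚ_[p]),
    fun j => (zpPow.ofNat p fun i => nodes (β i) (μ i) (j i)).2⟩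

theorem dist_nodePoint_lt {s : ℕ} {δ : ℝ} (hs : (p : ℝ) ^ (-(s : ℤ)) < δ) {β : Fin n → ℕ}
    {μ μ' : (i : Fin n) → Fin (β i + 1) → ℕ} (h : ∀ i k, μ i k ≡ μ' i k [MOD p ^ s]) :
    dist (nodePoint p β μ) (nodePoint p β μ') < δ := by
  have hδ : 0 < δ := (zpow_nonneg (Nat.cast_nonneg p) _).trans_lt hs
  rw [Subtype.dist_eq, dist_pi_lt_iff hδ]
  intro i
  rw [dist_pi_lt_iff hδ]
  intro j
  refine lt_of_le_of_lt ?_ hs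
  have hm := (nodes_modEq (p ^ s) (β i) (h i) j).symm
  rw [Nat.modEq_iff_dvd] at hm
  have := (Padic.norm_int_le_pow_iff_dvd (p := p) _ s).2 (by exact_mod_cast hm)
  rw [dist_eq_norm]
  push_cast at this
  exact this

end Domain

/-! ### Decay of the Mahler coefficients of `C^α`-functions -/

section Decay

variable {p : ℕ} [Fact p.Prime] {n : ℕ} {E : Type*} [AddCommGroup E] [Module ℚ_[p] E]

theorem mahlerCoeff_eq_multiMahler (f : zpPow p n → E) (ν : Fin n → ℕ) :
    mahlerCoeff f ν = multiMahler p (fun k => f (zpPow.ofNat p k)) ν := by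
  refine sum_congr rfl fun μ hμ => ?_
  congr 1
  simp only [mahlerEntry]
  rw [prod_mul_distrib, prod_pow_eq_pow_sum, sum_tsub_distrib _ fun i _ => mem_Iic.1 hμ i]

/-- A constant bounding the powers of `p` lost in the choice of nodes. -/
def decayConst (p : ℕ) (α : Fin n → ℕ) : ℝ := ∏ i, (1 + (p : ℝ) * α i) ^ α i

theorem decayConst_pos (p : ℕ) (α : Fin n → ℕ) : 0 < decayConst p α :=
  prod_pos fun _ _ => by positivity

theorem sum_Iic_eq_multiMahler {β : Fin n → ℕ} (idx : (i : Fin n) → Fin (β i + 1) → ℕ)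
    (F : ((i : Fin n) → Fin (β i + 1) → ℕ) → E) :
    ∑ μ ∈ Iic idx, (∏ i, ∏ k, mahlerEntry ℚ_[p] (idx i k) (μ i k)) • F μ =
      multiMahler p (fun m : (Σ i, Fin (β i + 1)) → ℕ => F fun i k => m ⟨i, k⟩)
        (fun s => idx s.1 s.2) := by
  rw [multiMahler]
  refine sum_nbij' (fun μ s => μ s.1 s.2) (fun m i k => m ⟨i, k⟩) ?_ ?_ ?_ ?_ ?_
  · intro μ hμ
    rw [mem_Iic] at hμ ⊢
    exact fun s => hμ s.1 s.2
  · intro m hm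
    rw [mem_Iic] at hm ⊢
    exact fun i k => hm ⟨i, k⟩
  · intro μ _
    rfl
  · intro m _
    rfl
  · intro μ _
    rw [Fintype.prod_sigma]

variable [TopologicalSpace E]

/-- Since `idx` has total $\nu$, large values of the left side at different $\nu$ come from
different coefficients of the node function; this is what finiteness needs. -/
theorem exists_mahlerCoeff_le {α β ν : Fin n → ℕ} (hβα : β ≤ α) (hβν : β ≤ ν) :
    ∃ idx : (i : Fin n) → Fin (β i + 1) → ℕ, (fun i => nodeTotal (β i) (idx i)) = ν ∧
      ∀ {f : zpPow p n → E} {g : extDomain (zpPow p n) β → E}, IsContExtension f β g →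
        ∀ q : Seminorm ℚ_[p] E, (mahlerWeight β ν : ℝ) * q (mahlerCoeff f ν) ≤
          decayConst p α * q (multiMahler p (fun m : (Σ i, Fin (β i + 1)) → ℕ =>
            g (nodePoint p β fun i k => m ⟨i, k⟩)) (fun s => idx s.1 s.2)) := by
  choose idx hidx hle using fun i => exists_nodeTotal_eq p (hβν i)
  refine ⟨idx, funext hidx, fun {f g} hg q => ?_⟩
  have h1 : ∀ μ : (i : Fin n) → Fin (β i + 1) → ℕ,
      ∑ j : (i : Fin n) → Fin (β i + 1), (∏ i, ∏ k ∈ univ.erase (j i),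
        ((nodes (β i) (μ i) (j i) : ℚ_[p]) - (nodes (β i) (μ i) k : ℚ_[p]))⁻¹) •
          f (zpPow.ofNat p fun i => nodes (β i) (μ i) (j i)) = g (nodePoint p β μ) := by
    intro μ
    rw [hg.2 _ fun i => Nat.cast_injective.comp (nodes_injective _ _)]
    rfl
  have h2 := multiMahler_nodeTotal (p := p) (fun k => f (zpPow.ofNat p k)) idx
  simp only [h1, hidx] at h2
  rw [sum_Iic_eq_multiMahler idx fun μ => g (nodePoint p β μ), ← mahlerCoeff_eq_multiMahler] at h2
  rw [h2, map_smul_eq_mul, ← mul_assoc]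
  refine mul_le_mul_of_nonneg_right ?_ (apply_nonneg _ _)
  rw [norm_prod]
  change (∏ i, (max 1 (ν i) : ℝ) ^ β i) * _ ≤ _
  rw [← prod_mul_distrib]
  refine prod_le_prod (fun _ _ => by positivity) fun i _ => (hle i).trans ?_
  have hβ : (β i : ℝ) ≤ α i := by exact_mod_cast hβα i
  have hp : (0 : ℝ) ≤ p := Nat.cast_nonneg p
  -- The extra $1$ in `decayConst` keeps the base at least $1$, so that the exponent may grow from
  -- $\beta_i$ to $\alpha_i$.
  have h3 : (p : ℝ) * β i ≤ 1 + p * α i := by nlinarith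
  exact (pow_le_pow_left₀ (by positivity) h3 _).trans
    (pow_le_pow_right₀ (by nlinarith [Nat.cast_nonneg (α := ℝ) (α i)]) (hβα i))

theorem mahlerWeight_mul_mahlerCoeff_le {α β ν : Fin n → ℕ} (hβα : β ≤ α) (hβν : β ≤ ν)
    {f : zpPow p n → E} {g : extDomain (zpPow p n) β → E} (hg : IsContExtension f β g)
    (q : ContUltraSeminorm ℚ_[p] E) {M : ℝ} (hM : 0 ≤ M) (h : ∀ x, q.1 (g x) ≤ M) :
    (mahlerWeight β ν : ℝ) * q.1 (mahlerCoeff f ν) ≤ decayConst p α * M := by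
  obtain ⟨idx, -, hle⟩ := exists_mahlerCoeff_le (p := p) (E := E) hβα hβν
  exact (hle hg q.1).trans (mul_le_mul_of_nonneg_left
    (multiMahler_le q.1 q.2.2 hM (fun k => h _) _) (decayConst_pos p α).le)

/-- The multi-index `α` with the entries exceeding those of `ν` replaced by zero. -/
def truncIndex (α ν : Fin n → ℕ) : Fin n → ℕ := fun i => if α i ≤ ν i then α i else 0

theorem truncIndex_le_left (α ν : Fin n → ℕ) : truncIndex α ν ≤ α := by
  intro i
  rw [truncIndex]
  split_ifs <;> simp

theorem truncIndex_le_right (α ν : Fin n → ℕ) : truncIndex α ν ≤ ν := by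
  intro i
  rw [truncIndex]
  split_ifs with h
  · exact h
  · exact Nat.zero_le _

/-- A constant comparing the weights of a multi-index and of its truncations. -/
def truncConst (α : Fin n → ℕ) : ℝ := ∏ i, (max 1 (α i) : ℝ) ^ α i

theorem truncConst_pos (α : Fin n → ℕ) : 0 < truncConst α := (mahlerWeight α α).2

/-- Order $\alpha_i$ is available for the node argument only if $\alpha_i\le\nu_i$. In the other
coordinates the weight is bounded by a constant, so no difference quotient is needed there. -/
theorem mahlerWeight_le_truncIndex (α ν : Fin n → ℕ) :
    (mahlerWeight α ν : ℝ) ≤ truncConst α * mahlerWeight (truncIndex α ν) ν := by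
  change ∏ i, (max 1 (ν i) : ℝ) ^ α i ≤
    (∏ i, (max 1 (α i) : ℝ) ^ α i) * ∏ i, (max 1 (ν i) : ℝ) ^ truncIndex α ν i
  rw [← prod_mul_distrib]
  refine prod_le_prod (fun _ _ => by positivity) fun i _ => ?_
  rw [truncIndex]
  split_ifs with h
  · exact le_mul_of_one_le_left (by positivity) (one_le_pow₀ (le_max_left _ _))
  · rw [pow_zero, mul_one]
    refine pow_le_pow_left₀ (by positivity) (max_le_max le_rfl ?_) _
    exact_mod_cast (not_le.1 h).le

theorem mahlerWeight_mul_mahlerCoeff_le_of_forall {α : Fin n → ℕ} {f : zpPow p n → E}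
    (q : ContUltraSeminorm ℚ_[p] E) {M : ℝ} (hM : 0 ≤ M)
    (h : ∀ β ≤ α, ∃ g, IsContExtension f β g ∧ ∀ x, q.1 (g x) ≤ M) (ν : Fin n → ℕ) :
    (mahlerWeight α ν : ℝ) * q.1 (mahlerCoeff f ν) ≤ truncConst α * (decayConst p α * M) := by
  obtain ⟨g, hg, hgM⟩ := h _ (truncIndex_le_left α ν)
  refine (mul_le_mul_of_nonneg_right (mahlerWeight_le_truncIndex α ν) (apply_nonneg _ _)).trans ?_
  rw [mul_assoc]
  exact mul_le_mul_of_nonneg_left (mahlerWeight_mul_mahlerCoeff_le (truncIndex_le_left α ν)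
    (truncIndex_le_right α ν) hg q hM hgM) (truncConst_pos α).le

end Decay

/-! ### Membership of the Mahler coefficients in the weighted $c_0$-space -/

section Finiteness

variable {p : ℕ} [Fact p.Prime] {n : ℕ} {E : Type*} [AddCommGroup E] [Module ℚ_[p] E]
  [UniformSpace E] [IsUniformAddGroup E]

theorem exists_modEq_imp_lt (q : ContUltraSeminorm ℚ_[p] E) {β : Fin n → ℕ}
    {g : extDomain (zpPow p n) β → E} (hg : Continuous g) {ε : ℝ} (hε : 0 < ε) :
    ∃ s : ℕ, ∀ μ μ' : (i : Fin n) → Fin (β i + 1) → ℕ, (∀ i k, μ i k ≡ μ' i k [MOD p ^ s]) →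
      q.1 (g (nodePoint p β μ) - g (nodePoint p β μ')) < ε := by
  have hu := CompactSpace.uniformContinuous_of_continuous hg
  have hW : {y : E | q.1 y < ε} ∈ 𝓝 (0 : E) :=
    (isOpen_Iio.preimage q.2.1).mem_nhds (by simpa using hε)
  have hU : {x : E × E | q.1 (x.1 - x.2) < ε} ∈ uniformity E := by
    rw [uniformity_eq_comap_nhds_zero_swapped]
    exact ⟨_, hW, fun x hx => hx⟩
  obtain ⟨δ, hδ, h⟩ := Metric.mem_uniformity_dist.1 (mem_map.1 (hu hU))
  obtain ⟨s, hs⟩ := PadicInt.exists_pow_neg_lt p hδ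
  exact ⟨s, fun μ μ' hμ => h (dist_nodePoint_lt hs hμ)⟩

theorem finite_le_mahlerWeight_mul_mahlerCoeff {α β : Fin n → ℕ} (hβα : β ≤ α)
    {f : zpPow p n → E} {g : extDomain (zpPow p n) β → E} (hg : IsContExtension f β g)
    (q : ContUltraSeminorm ℚ_[p] E) {ε : ℝ} (hε : 0 < ε) :
    {ν | β ≤ ν ∧ ε ≤ (mahlerWeight β ν : ℝ) * q.1 (mahlerCoeff f ν)}.Finite := by
  have hfin := finite_le_multiMahler q.1 q.2.2
    (G := fun m : (Σ i, Fin (β i + 1)) → ℕ => g (nodePoint p β fun i k => m ⟨i, k⟩))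
    (fun η hη => by
      obtain ⟨s, hs⟩ := exists_modEq_imp_lt q hg.1 hη
      exact ⟨s, fun k k' h => hs _ _ fun i j => h ⟨i, j⟩⟩)
    (div_pos hε (decayConst_pos p α))
  refine (hfin.image fun (m : (Σ i, Fin (β i + 1)) → ℕ) i =>
    nodeTotal (β i) fun k => m ⟨i, k⟩).subset ?_
  rintro ν ⟨hβν, hν⟩
  obtain ⟨idx, hidx, hle⟩ := exists_mahlerCoeff_le (p := p) (E := E) hβα hβν
  refine ⟨fun s => idx s.1 s.2, ?_, hidx⟩
  rw [Set.mem_ofPred, div_le_iff₀' (decayConst_pos p α)]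
  exact hν.trans (hle hg q.1)

theorem finite_le_mahlerWeight_mul_mahlerCoeff_of_forall {α : Fin n → ℕ} {f : zpPow p n → E}
    (h : ∀ β ≤ α, ∃ g, IsContExtension f β g) (q : ContUltraSeminorm ℚ_[p] E) {ε : ℝ}
    (hε : 0 < ε) : {ν | ε ≤ (mahlerWeight α ν : ℝ) * q.1 (mahlerCoeff f ν)}.Finite := by
  have hfin : (⋃ β ∈ Iic α, {ν | β ≤ ν ∧
      ε / truncConst α ≤ (mahlerWeight β ν : ℝ) * q.1 (mahlerCoeff f ν)}).Finite := by
    refine Set.Finite.biUnion (finite_toSet _) fun β hβ => ?_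
    obtain ⟨g, hg⟩ := h β (mem_Iic.1 hβ)
    exact finite_le_mahlerWeight_mul_mahlerCoeff (mem_Iic.1 hβ) hg q
      (div_pos hε (truncConst_pos α))
  refine hfin.subset fun ν hν => ?_
  refine Set.mem_biUnion (mem_Iic.2 (truncIndex_le_left α ν)) ⟨truncIndex_le_right α ν, ?_⟩
  rw [div_le_iff₀' (truncConst_pos α), ← mul_assoc]
  exact (Set.mem_ofPred.1 hν).trans
    (mul_le_mul_of_nonneg_right (mahlerWeight_le_truncIndex α ν) (apply_nonneg _ _))

end Finiteness

/-! ### Mahler series -/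

section Kernel

variable {p : ℕ} [Fact p.Prime] {n : ℕ}

variable (p) in
/-- The product of the binomial polynomials `x ↦ (xᵢ choose νᵢ)`. -/
def mahlerBasis (x : zpPow p n) (ν : Fin n → ℕ) : ℚ_[p] :=
  ∏ i, ((Ring.choose (⟨x.1 i, x.2 i⟩ : ℤ_[p]) (ν i) : ℤ_[p]) : ℚ_[p])

theorem mahlerBasis_ofNat (k ν : Fin n → ℕ) :
    mahlerBasis p (zpPow.ofNat p k) ν = ∏ i, ((k i).choose (ν i) : ℚ_[p]) := by
  refine prod_congr rfl fun i _ => ?_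
  have : (⟨(zpPow.ofNat p k).1 i, (zpPow.ofNat p k).2 i⟩ : ℤ_[p]) = (k i : ℤ_[p]) :=
    Subtype.ext (by simp [zpPow.ofNat])
  rw [this, Ring.choose_natCast, PadicInt.coe_natCast]

/-- The continuous extension of the iterated difference quotients of `mahlerBasis`. -/
def mahlerBasisDiff {V : Set (Fin n → ℚ_[p])} (hV : V ⊆ zpPow p n) {β : Fin n → ℕ}
    (x : extDomain V β) (ν : Fin n → ℕ) : ℚ_[p] :=
  ∏ i, chooseDiff (β i) (ν i) fun j => ⟨x.1 i j, norm_le_one_of_mem_extDomain hV x.2 i j⟩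

variable {V : Set (Fin n → ℚ_[p])} (hV : V ⊆ zpPow p n) {α β : Fin n → ℕ}

theorem continuous_mahlerBasisDiff (ν : Fin n → ℕ) :
    Continuous fun x : extDomain V β => mahlerBasisDiff hV x ν := by
  refine continuous_finsetProd _ fun i _ => (continuous_chooseDiff _ _).comp ?_
  refine continuous_pi fun j => Continuous.subtype_mk ?_ _
  exact (continuous_apply j).comp ((continuous_apply i).comp continuous_subtype_val)

theorem norm_mahlerBasisDiff_le (hβ : β ≤ α) (x : extDomain V β) (ν : Fin n → ℕ) :
    ‖mahlerBasisDiff hV x ν‖ ≤ mahlerWeight α ν := by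
  rw [mahlerBasisDiff, norm_prod]
  refine prod_le_prod (fun _ _ => norm_nonneg _) fun i _ => (norm_chooseDiff_le _ _ _).trans ?_
  exact pow_le_pow_right₀ (le_max_left _ _) (hβ i)

theorem norm_mahlerBasis_le (x : zpPow p n) (ν : Fin n → ℕ) :
    ‖mahlerBasis p x ν‖ ≤ mahlerWeight α ν := by
  rw [mahlerBasis, norm_prod]
  refine prod_le_prod (fun _ _ => norm_nonneg _) fun i _ => (PadicInt.norm_le_one _).trans ?_
  exact one_le_pow₀ (le_max_left _ _)

theorem sum_mahlerBasis_eq_mahlerBasisDiff {x : extDomain V β}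
    (hx : ∀ i, Function.Injective (x.1 i)) (ν : Fin n → ℕ) :
    ∑ j : (i : Fin n) → Fin (β i + 1),
      (∏ i, ∏ k ∈ univ.erase (j i), (x.1 i (j i) - x.1 i k)⁻¹) *
        mahlerBasis p (Set.inclusion hV ⟨fun i => x.1 i (j i), x.2 j⟩) ν =
      mahlerBasisDiff hV x ν := by
  have h : ∀ i, Function.Injective fun j =>
      (⟨x.1 i j, norm_le_one_of_mem_extDomain hV x.2 i j⟩ : ℤ_[p]) :=
    fun i a b hab => hx i (congrArg Subtype.val hab)
  simp only [mahlerBasisDiff, chooseDiff_eq_dividedDiff _ _ (h _), dividedDiff]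
  rw [Finset.prod_univ_sum, Fintype.piFinset_univ]
  refine sum_congr rfl fun j _ => ?_
  rw [prod_mul_distrib]
  rfl

end Kernel

/-! ### Mahler series define $C^\alpha$-functions -/

section SeriesSum

variable {p : ℕ} [Fact p.Prime] {n : ℕ} {E : Type*} [AddCommGroup E] [Module ℚ_[p] E]
  [UniformSpace E] [IsUniformAddGroup E] [ContinuousSMul ℚ_[p] E]

theorem isContExtension_extDiffQuot {U : Set (Fin n → ℚ_[p])} {α : Fin n → ℕ}
    (f : CAlphaSpace ℚ_[p] E U α) {β : Fin n → ℕ} (hβ : β ≤ α) {V : Set (Fin n → ℚ_[p])}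
    (hV : IsOpenCartesianIn V U) :
    IsContExtension (f.1 ∘ Set.inclusion hV.subset) β (extDiffQuot f hβ hV) :=
  (f.2 V hV β hβ).choose_spec

theorem exists_mahlerSeries [T2Space E] (hconv : IsUltraLocallyConvex ℚ_[p] E)
    (hcomplete : ∀ u : ℕ → E, CauchySeq u → ∃ a : E, Tendsto u atTop (𝓝 a))
    {α : Fin n → ℕ} (b : CZeroSpace ℚ_[p] E (mahlerWeight α)) :
    ∃ f : CAlphaSpace ℚ_[p] E (zpPow p n) α,
      (∀ x, Tendsto (fun N : ℕ => ∑ ν ∈ Iic (fun _ => N), mahlerBasis p x ν • b ν) atTop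
        (𝓝 (f x))) ∧
      ∀ (q : ContUltraSeminorm ℚ_[p] E) (β : Fin n → ℕ) (hβ : β ≤ α) (V : Set (Fin n → ℚ_[p]))
        (hV : IsOpenCartesianIn V (zpPow p n)) (x : extDomain V β),
        q.1 (extDiffQuot f hβ hV x) ≤ cZeroSeminorm (mahlerWeight α) q b := by
  obtain ⟨f, hf, -⟩ := exists_tendstoUniformly_sum hconv hcomplete b
    (norm_mahlerBasis_le (p := p) (n := n) (α := α)) (tendsto_Iic_const_atTop (Fin n))
  have hext : ∀ (β : Fin n → ℕ) (_ : β ≤ α) (V : Set (Fin n → ℚ_[p]))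
      (hV : IsOpenCartesianIn V (zpPow p n)), ∃ g : extDomain V β → E,
        IsContExtension (f ∘ Set.inclusion hV.subset) β g ∧
          ∀ (q : ContUltraSeminorm ℚ_[p] E) x, q.1 (g x) ≤ cZeroSeminorm (mahlerWeight α) q b := by
    intro β hβ V hV
    obtain ⟨g, hg, hgb⟩ := exists_tendstoUniformly_sum hconv hcomplete b
      (norm_mahlerBasisDiff_le hV.subset hβ) (tendsto_Iic_const_atTop (Fin n))
    refine ⟨g, ⟨hg.continuous (Frequently.of_forall fun N => ?_), fun x hx => ?_⟩, hgb⟩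
    · exact continuous_finsetSum _ fun ν _ =>
        (continuous_mahlerBasisDiff hV.subset ν).smul continuous_const
    -- At points with distinct entries the difference quotient is a finite combination of values of
    -- $f$, so it commutes with the limit of partial sums.
    · refine tendsto_nhds_unique (hg.tendsto_at x) ?_
      have h : Tendsto (fun N : ℕ => ∑ j : (i : Fin n) → Fin (β i + 1),
          (∏ i, ∏ k ∈ univ.erase (j i), (x.1 i (j i) - x.1 i k)⁻¹) •
            ∑ ν ∈ Iic (fun _ => N),
              mahlerBasis p (Set.inclusion hV.subset ⟨fun i => x.1 i (j i), x.2 j⟩) ν • b ν)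
          atTop (𝓝 (diffQuot (f ∘ Set.inclusion hV.subset) β x)) :=
        tendsto_finsetSum _ fun j _ => (hf.tendsto_at _).const_smul _
      refine h.congr fun N => ?_
      simp only [smul_sum, smul_smul]
      rw [sum_comm]
      refine sum_congr rfl fun ν _ => ?_
      rw [← sum_smul, sum_mahlerBasis_eq_mahlerBasisDiff hV.subset hx]
  let F : cAlphaSubmodule ℚ_[p] E (zpPow p n) α :=
    ⟨f, fun V hV β hβ => (hext β hβ V hV).imp fun _ h => h.1⟩
  refine ⟨F, hf.tendsto_at, fun q β hβ V hV x => ?_⟩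
  obtain ⟨g, hg, hgb⟩ := hext β hβ V hV
  rw [IsContExtension.unique hV.isCartesian (isContExtension_extDiffQuot F hβ hV) hg]
  exact hgb q x

end SeriesSum

/-! ### The Mahler isomorphism -/

section Isomorphism

variable {p : ℕ} [Fact p.Prime] {n : ℕ} {E : Type*} [AddCommGroup E] [Module ℚ_[p] E]

theorem mahlerCoeff_add (f g : zpPow p n → E) (ν : Fin n → ℕ) :
    mahlerCoeff (f + g) ν = mahlerCoeff f ν + mahlerCoeff g ν := by
  simp [mahlerCoeff, sum_add_distrib]

theorem mahlerCoeff_smul (c : ℚ_[p]) (f : zpPow p n → E) (ν : Fin n → ℕ) :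
    mahlerCoeff (c • f) ν = c • mahlerCoeff f ν := by
  simp only [mahlerCoeff, Pi.smul_apply, smul_sum]
  exact sum_congr rfl fun _ _ => smul_comm _ _ _

theorem sum_mahlerEntry_mul_choose (m l : ℕ) :
    ∑ k ∈ Iic m, mahlerEntry ℚ_[p] m k * (k.choose l : ℚ_[p]) = if m = l then 1 else 0 := by
  have h := fwdDiff_iter_choose_zero l m
  rw [fwdDiff_iter_eq_sum_shift, Nat.range_succ_eq_Iic] at h
  have h' := congrArg (fun z : ℤ => (z : ℚ_[p])) h
  push_cast at h'
  rw [← h']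
  refine sum_congr rfl fun k _ => ?_
  simp [mahlerEntry]

theorem mahlerCoeff_of_forall_ofNat {f : zpPow p n → E} {b : (Fin n → ℕ) → E} {ν : Fin n → ℕ}
    (h : ∀ k ≤ ν, f (zpPow.ofNat p k) =
      ∑ μ ∈ Iic ν, (∏ i, ((k i).choose (μ i) : ℚ_[p])) • b μ) :
    mahlerCoeff f ν = b ν := by
  rw [mahlerCoeff_eq_multiMahler, multiMahler]
  rw [sum_congr rfl fun k hk => by rw [h k (mem_Iic.1 hk)]]
  simp only [smul_sum, smul_smul]
  rw [sum_comm]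
  have h1 : ∀ μ : Fin n → ℕ, ∑ k ∈ Iic ν, ((∏ i, mahlerEntry ℚ_[p] (ν i) (k i)) *
      ∏ i, ((k i).choose (μ i) : ℚ_[p])) = if ν = μ then 1 else 0 := by
    intro μ
    rw [sum_prod_mahlerEntry_mul (fun i k => (k.choose (μ i) : ℚ_[p]))]
    simp only [sum_mahlerEntry_mul_choose]
    rw [Fintype.prod_boole]
    simp only [funext_iff]
    congr
  simp only [← sum_smul, h1]
  rw [sum_eq_single ν]
  · simp
  · intro μ _ hμ
    simp [hμ.symm]
  · simp

/-- The system is triangular with diagonal entries $1$. -/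
theorem eq_zero_of_mahlerCoeff_eq_zero {f : zpPow p n → E} (h : ∀ ν, mahlerCoeff f ν = 0)
    (k : Fin n → ℕ) : f (zpPow.ofNat p k) = 0 := by
  induction k using WellFoundedLT.induction with
  | ind k ih =>
    have hk := h k
    rw [mahlerCoeff_eq_multiMahler, multiMahler, sum_eq_single k] at hk
    · simpa [mahlerEntry] using hk
    · intro μ hμ hne
      rw [ih μ (lt_of_le_of_ne (mem_Iic.1 hμ) hne), smul_zero]
    · simp

theorem denseRange_ofNat : DenseRange (zpPow.ofNat p (n := n)) := by
  intro x
  rw [Metric.mem_closure_range_iff]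
  intro ε hε
  choose k hk using fun i => PadicInt.denseRange_natCast.exists_dist_lt
    (⟨x.1 i, x.2 i⟩ : ℤ_[p]) hε
  refine ⟨k, ?_⟩
  rw [Subtype.dist_eq, dist_pi_lt_iff hε]
  intro i
  have : dist (x.1 i) ((k i : ℤ_[p]) : ℚ_[p]) < ε := hk i
  simpa [zpPow.ofNat] using this

theorem IsContExtension.continuous [TopologicalSpace E] {f : zpPow p n → E}
    {g : extDomain (zpPow p n) 0 → E} (hg : IsContExtension f 0 g) : Continuous f := by
  let φ : zpPow p n → extDomain (zpPow p n) 0 := fun x => ⟨fun i _ => x.1 i, fun _ => x.2⟩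
  have hφ : Continuous φ := by
    refine Continuous.subtype_mk (continuous_pi fun i => continuous_pi fun _ => ?_) _
    exact (continuous_apply i).comp continuous_subtype_val
  have h : f = g ∘ φ := by
    ext x
    have hinj : ∀ i, Function.Injective ((φ x).1 i) := fun i a b _ =>
      Subsingleton.elim (α := Fin 1) a b
    rw [Function.comp_apply, hg.2 (φ x) hinj, diffQuot]
    have : ∀ j : (i : Fin n) → Fin ((0 : Fin n → ℕ) i + 1),
        (∏ i, ∏ k ∈ univ.erase (j i), ((φ x).1 i (j i) - (φ x).1 i k)⁻¹) = 1 := by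
      intro j
      refine prod_eq_one fun i _ => prod_eq_one fun k hk => ?_
      exact absurd (Subsingleton.elim (α := Fin 1) k (j i)) (ne_of_mem_erase hk)
    simp only [this, one_smul]
    change f x = ∑ _j : (i : Fin n) → Fin 1, f x
    simp
  rw [h]
  exact hg.1.comp hφ

end Isomorphism

/-! ### The topologies on both spaces and linearity of $f\mapsto (f|_V)^{<\beta>}$ -/

section Topologies

variable {p : ℕ} [Fact p.Prime] {n : ℕ} {E : Type*} [AddCommGroup E] [Module ℚ_[p] E]
  [UniformSpace E]

theorem withSeminorms_cZeroSpace {X : Type*} (w : X → Set.Ioi (0 : ℝ)) :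
    WithSeminorms fun q : ContUltraSeminorm ℚ_[p] E => cZeroSeminorm (𝕜 := ℚ_[p]) (E := E) w q :=
  ⟨rfl⟩

variable [IsUniformAddGroup E] [ContinuousSMul ℚ_[p] E]

variable {U : Set (Fin n → ℚ_[p])} {α β : Fin n → ℕ} {V : Set (Fin n → ℚ_[p])}

theorem continuous_extDiffQuot (hβ : β ≤ α) (hV : IsOpenCartesianIn V U) :
    Continuous fun f : CAlphaSpace ℚ_[p] E U α => extDiffQuot f hβ hV :=
  continuous_iff_le_induced.2
    (iInf_le_of_le β (iInf_le_of_le hβ (iInf_le_of_le V (iInf_le_of_le hV le_rfl))))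

variable [T2Space E]

/-- The map `f ↦ (f|_V)^{<β>}` as a linear map. -/
def extDiffQuotLinear (hβ : β ≤ α) (hV : IsOpenCartesianIn V U) :
    CAlphaSpace ℚ_[p] E U α →ₗ[ℚ_[p]] C(extDomain V β, E) where
  toFun f := extDiffQuot f hβ hV
  map_add' f g := DFunLike.coe_injective <| by
    refine IsContExtension.unique hV.isCartesian (isContExtension_extDiffQuot (f + g) hβ hV)
      ⟨ContinuousMap.continuous _, fun x hx => ?_⟩
    rw [ContinuousMap.add_apply, (isContExtension_extDiffQuot f hβ hV).2 x hx,
      (isContExtension_extDiffQuot g hβ hV).2 x hx]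
    simp only [diffQuot, ← sum_add_distrib, ← smul_add]
    rfl
  map_smul' c f := DFunLike.coe_injective <| by
    refine IsContExtension.unique hV.isCartesian (isContExtension_extDiffQuot (c • f) hβ hV)
      ⟨ContinuousMap.continuous _, fun x hx => ?_⟩
    rw [RingHom.id_apply, ContinuousMap.smul_apply,
      (isContExtension_extDiffQuot f hβ hV).2 x hx]
    simp only [diffQuot, smul_sum]
    exact sum_congr rfl fun j _ => smul_comm _ _ _

instance isTopologicalAddGroup_cAlphaSpace :
    IsTopologicalAddGroup (CAlphaSpace ℚ_[p] E U α) :=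
  topologicalAddGroup_iInf fun _ => topologicalAddGroup_iInf fun hβ =>
    topologicalAddGroup_iInf fun _ => topologicalAddGroup_iInf fun hV =>
      topologicalAddGroup_induced (extDiffQuotLinear hβ hV)

end Topologies

/-! ### Bijectivity and continuity in both directions -/

section Equiv

variable {p : ℕ} [Fact p.Prime] {n : ℕ} {E : Type*} [AddCommGroup E] [Module ℚ_[p] E]
  [UniformSpace E] [IsUniformAddGroup E] [ContinuousSMul ℚ_[p] E]

variable (p E) in
/-- The linear map taking a `C^α`-function to its Mahler coefficients. -/
def mahlerLinear (α : Fin n → ℕ) :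
    CAlphaSpace ℚ_[p] E (zpPow p n) α →ₗ[ℚ_[p]] CZeroSpace ℚ_[p] E (mahlerWeight α) where
  toFun f := (⟨fun ν => mahlerCoeff f ν, fun q ε hε => by
    have h := finite_le_mahlerWeight_mul_mahlerCoeff_of_forall (f := f.1)
      (fun β hβ => f.2 (zpPow p n) isOpenCartesianIn_zpPow β hβ) q hε
    exact ⟨h.toFinset, fun ν hν => by simpa using hν⟩⟩ :
      cZeroSubmodule ℚ_[p] E (mahlerWeight α))
  map_add' f g := Subtype.ext (funext fun ν => mahlerCoeff_add f.1 g.1 ν)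
  map_smul' c f := Subtype.ext (funext fun ν => mahlerCoeff_smul c f.1 ν)

theorem mahlerLinear_apply {α : Fin n → ℕ} (f : CAlphaSpace ℚ_[p] E (zpPow p n) α)
    (ν : Fin n → ℕ) : mahlerLinear p E α f ν = mahlerCoeff f ν := rfl

variable [T2Space E]

theorem mahlerLinear_injective (α : Fin n → ℕ) : Function.Injective (mahlerLinear p E α) := by
  rw [← LinearMap.ker_eq_bot, LinearMap.ker_eq_bot']
  intro f hf
  have h0 : ∀ ν, mahlerCoeff f.1 ν = 0 := fun ν => by rw [← mahlerLinear_apply, hf]; rfl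
  obtain ⟨g, hg⟩ := f.2 (zpPow p n) isOpenCartesianIn_zpPow 0 (fun i => Nat.zero_le _)
  have hc : Continuous f.1 := IsContExtension.continuous hg
  exact Subtype.ext (denseRange_ofNat.equalizer hc continuous_const
    (funext fun k => eq_zero_of_mahlerCoeff_eq_zero h0 k))

/-- As $(\mathbb Z_p^n)^{<\beta>}$ is compact, a bound on $q\circ f^{<\beta>}$ over all of it is an
open condition, and only finitely many $\beta\le\alpha$ occur. -/
theorem continuous_mahlerLinear (α : Fin n → ℕ) : Continuous (mahlerLinear p E α) := by
  refine (withSeminorms_cZeroSpace (mahlerWeight α)).continuous_of_continuous_comp _ fun q => ?_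
  refine Seminorm.continuous_of_forall fun r hr => ?_
  set D : ℝ := truncConst α * decayConst p α with hD
  have hD0 : 0 < D := mul_pos (truncConst_pos α) (decayConst_pos p α)
  -- Halving $r$ keeps the supremum strictly below $r$.
  set M : ℝ := r / 2 / D with hM
  have hM0 : 0 < M := by positivity
  have hmem : ∀ β ∈ Iic α, {f : CAlphaSpace ℚ_[p] E (zpPow p n) α | ∀ hβ : β ≤ α,
      ∀ x, q.1 (extDiffQuot f hβ isOpenCartesianIn_zpPow x) < M} ∈ 𝓝 0 := by
    intro β hβ
    rw [mem_Iic] at hβ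
    have ho : IsOpen {g : C(extDomain (zpPow p n) β, E) |
        Set.MapsTo g Set.univ {y | q.1 y < M}} :=
      ContinuousMap.isOpen_setOfPred_mapsTo isCompact_univ (isOpen_Iio.preimage q.2.1)
    refine mem_of_superset ((ho.preimage
      (continuous_extDiffQuot hβ isOpenCartesianIn_zpPow)).mem_nhds ?_) fun f hf _ x =>
        hf (Set.mem_univ x)
    intro x _
    have h0 : extDiffQuot (0 : CAlphaSpace ℚ_[p] E (zpPow p n) α) hβ isOpenCartesianIn_zpPow = 0 :=
      map_zero (extDiffQuotLinear hβ isOpenCartesianIn_zpPow)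
    change q.1 (extDiffQuot (0 : CAlphaSpace ℚ_[p] E (zpPow p n) α) hβ isOpenCartesianIn_zpPow x) < M
    rw [h0, ContinuousMap.zero_apply, map_zero]
    exact hM0
  refine mem_of_superset ((biInter_finset_mem _).2 hmem) fun f hf => ?_
  rw [Seminorm.mem_ball_zero, Seminorm.comp_apply]
  have hle : cZeroSeminorm (mahlerWeight α) q (mahlerLinear p E α f) ≤ r / 2 := by
    refine Real.iSup_le (fun ν => ?_) (by positivity)
    have := mahlerWeight_mul_mahlerCoeff_le_of_forall (f := f.1) q hM0.le (fun β hβ =>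
      ⟨extDiffQuot f hβ isOpenCartesianIn_zpPow,
        isContExtension_extDiffQuot f hβ isOpenCartesianIn_zpPow, fun x =>
        ((Set.mem_iInter₂.1 hf β (mem_Iic.2 hβ)) hβ x).le⟩) ν
    rwa [← mul_assoc, ← hD, hM, mul_div_cancel₀ _ hD0.ne'] at this
  exact hle.trans_lt (half_lt_self hr)

theorem exists_mahlerLinear_eq (hconv : IsUltraLocallyConvex ℚ_[p] E)
    (hcomplete : ∀ u : ℕ → E, CauchySeq u → ∃ a : E, Tendsto u atTop (𝓝 a))
    {α : Fin n → ℕ} (b : CZeroSpace ℚ_[p] E (mahlerWeight α)) :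
    ∃ f : CAlphaSpace ℚ_[p] E (zpPow p n) α, mahlerLinear p E α f = b ∧
      ∀ (q : ContUltraSeminorm ℚ_[p] E) (β : Fin n → ℕ) (hβ : β ≤ α) (V : Set (Fin n → ℚ_[p]))
        (hV : IsOpenCartesianIn V (zpPow p n)) (x : extDomain V β),
        q.1 (extDiffQuot f hβ hV x) ≤ cZeroSeminorm (mahlerWeight α) q b := by
  obtain ⟨f, hf, hfb⟩ := exists_mahlerSeries hconv hcomplete b
  refine ⟨f, Subtype.ext (funext fun ν => ?_), hfb⟩
  refine mahlerCoeff_of_forall_ofNat (f := f.1) (b := b.1) fun k hk => ?_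
  -- At a point $k\le\nu$ the binomial product vanishes unless $\mu\le k$, so the partial sums are
  -- constant once the box contains all $\mu\le\nu$.
  refine tendsto_nhds_unique (hf _) (tendsto_const_nhds.congr' ?_)
  filter_upwards [(tendsto_Iic_const_atTop (Fin n)).eventually (eventually_ge_atTop (Iic ν))]
    with N hN
  simp only [mahlerBasis_ofNat]
  refine sum_subset hN fun μ _ hμ => ?_
  obtain ⟨i, hi⟩ := not_forall.1 (fun h => hμ (mem_Iic.2 h))
  rw [prod_eq_zero (mem_univ i), zero_smul]
  rw [Nat.choose_eq_zero_of_lt ((hk i).trans_lt (not_le.1 hi)), Nat.cast_zero]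

theorem extDiffQuot_le (hconv : IsUltraLocallyConvex ℚ_[p] E)
    (hcomplete : ∀ u : ℕ → E, CauchySeq u → ∃ a : E, Tendsto u atTop (𝓝 a))
    {α β : Fin n → ℕ} (f : CAlphaSpace ℚ_[p] E (zpPow p n) α)
    (q : ContUltraSeminorm ℚ_[p] E) (hβ : β ≤ α) {V : Set (Fin n → ℚ_[p])}
    (hV : IsOpenCartesianIn V (zpPow p n)) (x : extDomain V β) :
    q.1 (extDiffQuot f hβ hV x) ≤ cZeroSeminorm (mahlerWeight α) q (mahlerLinear p E α f) := by
  obtain ⟨g, hg, hgb⟩ := exists_mahlerLinear_eq hconv hcomplete (mahlerLinear p E α f)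
  rw [← mahlerLinear_injective α hg]
  rw [mahlerLinear_injective α hg] at hgb ⊢
  exact hgb q β hβ V hV x

theorem exists_mahlerEquiv (hconv : IsUltraLocallyConvex ℚ_[p] E)
    (hcomplete : ∀ u : ℕ → E, CauchySeq u → ∃ a : E, Tendsto u atTop (𝓝 a))
    (α : Fin n → ℕ) :
    ∃ A : CAlphaSpace ℚ_[p] E (zpPow p n) α ≃L[ℚ_[p]] CZeroSpace ℚ_[p] E (mahlerWeight α),
      ∀ (f : CAlphaSpace ℚ_[p] E (zpPow p n) α) (ν : Fin n → ℕ),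
        (A f) ν = mahlerCoeff f ν := by
  let e := LinearEquiv.ofBijective (mahlerLinear p E α) ⟨mahlerLinear_injective α, fun b =>
    (exists_mahlerLinear_eq hconv hcomplete b).imp fun _ h => h.1⟩
  have hw := withSeminorms_cZeroSpace (p := p) (E := E) (mahlerWeight α)
  have : IsTopologicalAddGroup (CZeroSpace ℚ_[p] E (mahlerWeight α)) := hw.topologicalAddGroup
  refine ⟨⟨e, continuous_mahlerLinear α, ?_⟩, fun f ν => rfl⟩
  refine continuous_iInf_rng.2 fun β => continuous_iInf_rng.2 fun hβ =>
    continuous_iInf_rng.2 fun V => continuous_iInf_rng.2 fun hV => continuous_induced_rng.2 ?_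
  let L : CZeroSpace ℚ_[p] E (mahlerWeight α) →ₗ[ℚ_[p]] C(extDomain V β, E) :=
    (extDiffQuotLinear hβ hV).comp e.symm.toLinearMap
  change Continuous L
  refine continuous_of_continuousAt_zero L ?_
  rw [ContinuousAt, map_zero, ContinuousMap.tendsto_iff_forall_isCompact_tendstoUniformlyOn]
  -- The bound `extDiffQuot_le` is uniform on all of $V^{<\beta>}$, so compactness of $K$ plays no
  -- role.
  intro K _ u hu
  obtain ⟨q, hq⟩ := exists_contUltraSeminorm_uniformity hconv hu
  have hball : {b | cZeroSeminorm (mahlerWeight α) q b < 1} ∈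
      𝓝 (0 : CZeroSpace ℚ_[p] E (mahlerWeight α)) :=
    (isOpen_Iio.preimage (hw.continuous_seminorm q)).mem_nhds
      ((map_zero (cZeroSeminorm (mahlerWeight α) q)).trans_lt one_pos)
  filter_upwards [hball] with b hb x _
  refine hq _ _ ?_
  rw [ContinuousMap.zero_apply, sub_zero]
  refine (extDiffQuot_le hconv hcomplete (e.symm b) q hβ hV x).trans_lt ?_
  have he : mahlerLinear p E α (e.symm b) = b := e.apply_symm_apply b
  rw [he]
  exact hb

end Equiv

end CAlphaMahler

end

theorem mainTheorem5 (p : ℕ) [Fact p.Prime] (n : ℕ) (hn : 0 < n) (α : Fin n → ℕ)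
    (E : Type*) [AddCommGroup E] [Module ℚ_[p] E] [UniformSpace E] [IsUniformAddGroup E]
    [ContinuousSMul ℚ_[p] E] [T2Space E]
    (hconv : IsUltraLocallyConvex ℚ_[p] E)
    (hcomplete : ∀ u : ℕ → E, CauchySeq u → ∃ a : E, Filter.Tendsto u Filter.atTop (𝓝 a)) :
    ∃ A : CAlphaSpace ℚ_[p] E (zpPow p n) α ≃L[ℚ_[p]] CZeroSpace ℚ_[p] E (mahlerWeight α),
      ∀ (f : CAlphaSpace ℚ_[p] E (zpPow p n) α) (ν : Fin n → ℕ),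
        (A f) ν = mahlerCoeff f ν :=
  CAlphaMahler.exists_mahlerEquiv hconv hcomplete α
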